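/- Fix the orthonormal (incoherent) basis $|1\rangle,\dots,|d\rangle$ of $\mathcal H_A=\mathbb C^d$, and on $\mathcal H_A\otimes\mathcal H_C$ use the product basis. Incoherent states are the diagonal density matrices. An operator $K$ is *incoherent-preserving* if $K\delta K^\dagger/\operatorname{Tr}(K\delta K^\dagger)$ is incoherent for every incoherent $\delta$ with $\operatorname{Tr}(K\delta K^\dagger)\ne0$. IO (resp. SIO) is the class of channels $\Lambda(\rho)=\sum_nK_n\rho K_n^\dagger$, $\sum_nK_n^\dagger K_n=\mathbb I$, with all $K_n$ (resp. all $K_n$ and all $K_n^\dagger$) incoherent-preserving. Let $|\Psi_N\rangle=N^{-1/2}\sum_{i=1}^N|i\rangle\in\mathcal H_A$ for $1\le N\le d$, and $\mathrm P(\rho,\sigma)=\sqrt{1-\mathrm F(\rho,\sigma)^2}$ with $\mathrm F(\rho,\sigma)=\operatorname{Tr}\sqrt{\sqrt\rho\,\sigma\sqrt\rho}$. Write $\psi=|\psi\rangle\langle\psi|$; logarithms are to base $2$. For $\mathcal O\in\{\mathrm{IO},\mathrm{SIO}\}$, $\varepsilon\ge0$, a state $\rho$ on $\mathcal H_A$ and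 a unit vector $|\phi\rangle\in\mathcal H_A$: - $C^\varepsilon_{\mathcal O,d}(\rho)$ is the maximum of $\log N$ over $1\le N\le d$ such that $\mathrm P(\Lambda(\rho),\Psi_N)\le\varepsilon$ for some $\Lambda\in\mathcal O$ on $\mathcal H_A$; $\tilde C^\varepsilon_{\mathcal O,d}(\phi)$ is the same maximum for $\rho=\phi$ with $\Lambda(\phi)$ required to be pure. - $C^\varepsilon_{\mathcal O,pc}(\rho)$ is the maximum of $\log N$ over $1\le N\le d$ for which there are a finite-dimensional $\mathcal H_C$, a unit vector $|\omega\rangle\in\mathcal H_C$ and $\Lambda\in\mathcal O$ on $\mathcal H_A\otimes\mathcal H_C$ with $\operatorname{Tr}_A\Lambda(\rho\otimes\omega)=\omega$ and $\mathrm P(\operatorname{Tr}_C\Lambda(\rho\otimes\omega),\Psi_N)\le\varepsilon$; $\tilde C^\varepsilon_{\mathcal O,pc}(\phi)$ is the same maximum for $\rho=\phi$ with $\operatorname{Tr}_C\Lambda(\phi\otimes\omega)$ required to be pure. **Theorem.** Let $|\phi\rangle\in\mathcal H_A$ be a unit vector with $r>1$ non-zero coefficients in the incoherent basis, and let $\phi_{\max}=\max_i|\langle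 i|\phi\rangle|^2$. The maxima defining $\tilde C^\varepsilon_{\mathcal O,d}(\phi)$, $\tilde C^\varepsilon_{\mathcal O,pc}(\phi)$ for $\varepsilon\ge0$, and $C^0_{\mathcal O,d}(\phi)$, $C^0_{\mathcal O,pc}(\phi)$, exist, and: 1. For every $\varepsilon\ge0$ with $r(r-1)\varepsilon\le1$, $$\tilde C^\varepsilon_{\mathrm{IO},d}(\phi)\le\tilde C^\varepsilon_{\mathrm{IO},pc}(\phi)\le\tilde C^{\sqrt{r(r-1)\varepsilon}}_{\mathrm{IO},d}(\phi),\qquad \tilde C^\varepsilon_{\mathrm{IO},d}(\phi)=\tilde C^\varepsilon_{\mathrm{SIO},d}(\phi),\qquad \tilde C^\varepsilon_{\mathrm{IO},pc}(\phi)=\tilde C^\varepsilon_{\mathrm{SIO},pc}(\phi).$$ 2. For exact distillation and $\mathcal O\in\{\mathrm{IO},\mathrm{SIO}\}$, $$C^0_{\mathcal O,d}(\phi)=C^0_{\mathcal O,pc}(\phi)=\tilde C^0_{\mathcal O,d}(\phi)=\tilde C^0_{\mathcal O,pc}(\phi)=\log\lfloor1/\phi_{\max}\rfloor .$$ -/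

import Mathlib

open scoped ComplexOrder Kronecker MatrixOrder Matrix.Norms.L2Operator

noncomputable section

namespace Coherence

/-- Density matrices. -/
def IsState {ι : Type} [Fintype ι] (ρ : Matrix ι ι ℂ) : Prop :=
  ρ.PosSemidef ∧ ρ.trace = 1

/-- Incoherent states: diagonal density matrices `∑ i, p i |i⟩⟨i|`. -/
def IsIncoherentState {ι : Type} [Fintype ι] [DecidableEq ι] (δ : Matrix ι ι ℂ) : Prop :=
  ∃ p : ι → ℝ, (∀ i, 0 ≤ p i) ∧ ∑ i, p i = 1 ∧ δ = Matrix.diagonal fun i => (p i : ℂ)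

/-- `K` sends every incoherent state `δ` to an incoherent state after normalization
(whenever the outcome has non-zero probability `Tr (K δ K†)`). -/
def IsIncoherentPreserving {ι : Type} [Fintype ι] [DecidableEq ι] (K : Matrix ι ι ℂ) : Prop :=
  ∀ δ : Matrix ι ι ℂ, IsIncoherentState δ → (K * δ * K.conjTranspose).trace ≠ 0 →
    IsIncoherentState ((K * δ * K.conjTranspose).trace⁻¹ • (K * δ * K.conjTranspose))

/-- `K` is a Kraus representation of the map `Λ`, which is trace preserving. -/
def IsKraus {ι : Type} [Fintype ι] [DecidableEq ι] {k : ℕ} (K : Fin k → Matrix ι ι ℂ)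
    (Λ : Matrix ι ι ℂ → Matrix ι ι ℂ) : Prop :=
  ∑ n, (K n).conjTranspose * K n = 1 ∧ ∀ X, Λ X = ∑ n, K n * X * (K n).conjTranspose

/-- The two classes of free operations: incoherent and strictly incoherent operations. -/
inductive OpClass : Type
  | incoherent : OpClass
  | strictlyIncoherent : OpClass

/-- `O.Mem Λ`: the map `Λ` is a channel of the class `O`. -/
def OpClass.Mem {ι : Type} [Fintype ι] [DecidableEq ι] (O : OpClass)
    (Λ : Matrix ι ι ℂ → Matrix ι ι ℂ) : Prop :=
  match O with
  | .incoherent => ∃ (k : ℕ) (K : Fin k → Matrix ι ι ℂ), IsKraus K Λ ∧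
      ∀ n, IsIncoherentPreserving (K n)
  | .strictlyIncoherent => ∃ (k : ℕ) (K : Fin k → Matrix ι ι ℂ), IsKraus K Λ ∧
      ∀ n, IsIncoherentPreserving (K n) ∧ IsIncoherentPreserving (K n).conjTranspose

/-- The rank-one operator `|ψ⟩⟨ψ|`. -/
def proj {ι : Type} [Fintype ι] (ψ : EuclideanSpace ℂ ι) : Matrix ι ι ℂ :=
  Matrix.of fun i j => ψ i * star (ψ j)

/-- The maximally coherent state `Ψ_N = N^{-1/2} ∑_{i < N} |i⟩` inside the `d`-dimensional
space (used for `1 ≤ N ≤ d`). -/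
def maxCoherent (d N : ℕ) : EuclideanSpace ℂ (Fin d) :=
  WithLp.toLp 2 fun i => if (i : ℕ) < N then ((1 / Real.sqrt N : ℝ) : ℂ) else 0

/-- Fidelity `F(ρ,σ) = Tr √(√ρ σ √ρ)`. -/
def fidelity {ι : Type} [Fintype ι] [DecidableEq ι] (ρ σ : Matrix ι ι ℂ) : ℝ :=
  (CFC.sqrt (CFC.sqrt ρ * σ * CFC.sqrt ρ)).trace.re

/-- Purified distance `P(ρ,σ) = √(1 - F(ρ,σ)²)`. -/
def purifiedDist {ι : Type} [Fintype ι] [DecidableEq ι] (ρ σ : Matrix ι ι ℂ) : ℝ :=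
  Real.sqrt (1 - fidelity ρ σ ^ 2)

/-- Partial trace over the first tensor factor (the system of interest). -/
def traceA {α β : Type} [Fintype α] (X : Matrix (α × β) (α × β) ℂ) : Matrix β β ℂ :=
  Matrix.of fun j j' => ∑ i, X (i, j) (i, j')

/-- Partial trace over the second tensor factor (the catalyst). -/
def traceC {α β : Type} [Fintype β] (X : Matrix (α × β) (α × β) ℂ) : Matrix α α ℂ :=
  Matrix.of fun i i' => ∑ j, X (i, j) (i', j)

/-- Feasible `N` for one-shot distillation from `ρ` with error `ε`. -/
def distillSet (O : OpClass) (ε : ℝ) {d : ℕ} (ρ : Matrix (Fin d) (Fin d) ℂ) : Set ℕ :=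
  {N | 1 ≤ N ∧ N ≤ d ∧ ∃ Λ : Matrix (Fin d) (Fin d) ℂ → Matrix (Fin d) (Fin d) ℂ,
    O.Mem Λ ∧ purifiedDist (Λ ρ) (proj (maxCoherent d N)) ≤ ε}

/-- Feasible `N` for one-shot distillation from `ρ` with a perfect pure catalyst
of arbitrary finite dimension. -/
def distillPcSet (O : OpClass) (ε : ℝ) {d : ℕ} (ρ : Matrix (Fin d) (Fin d) ℂ) : Set ℕ :=
  {N | 1 ≤ N ∧ N ≤ d ∧ ∃ (m : ℕ)
    (Λ : Matrix (Fin d × Fin m) (Fin d × Fin m) ℂ → Matrix (Fin d × Fin m) (Fin d × Fin m) ℂ)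
    (ω : EuclideanSpace ℂ (Fin m)) (ρout : Matrix (Fin d) (Fin d) ℂ),
    O.Mem Λ ∧ ‖ω‖ = 1 ∧ IsState ρout ∧
    traceA (Λ (ρ ⊗ₖ proj ω)) = proj ω ∧ traceC (Λ (ρ ⊗ₖ proj ω)) = ρout ∧
    purifiedDist ρout (proj (maxCoherent d N)) ≤ ε}

/-- Feasible `N` for one-shot distillation from `φ` with pure output. -/
def pureDistillSet (O : OpClass) (ε : ℝ) {d : ℕ} (φ : EuclideanSpace ℂ (Fin d)) : Set ℕ :=
  {N | 1 ≤ N ∧ N ≤ d ∧ ∃ (Λ : Matrix (Fin d) (Fin d) ℂ → Matrix (Fin d) (Fin d) ℂ)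
    (φout : EuclideanSpace ℂ (Fin d)),
    O.Mem Λ ∧ ‖φout‖ = 1 ∧ Λ (proj φ) = proj φout ∧
    purifiedDist (proj φout) (proj (maxCoherent d N)) ≤ ε}

/-- Feasible `N` for one-shot distillation from `φ` with pure output and a perfect pure
catalyst of arbitrary finite dimension. -/
def pureDistillPcSet (O : OpClass) (ε : ℝ) {d : ℕ} (φ : EuclideanSpace ℂ (Fin d)) : Set ℕ :=
  {N | 1 ≤ N ∧ N ≤ d ∧ ∃ (m : ℕ)
    (Λ : Matrix (Fin d × Fin m) (Fin d × Fin m) ℂ → Matrix (Fin d × Fin m) (Fin d × Fin m) ℂ)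
    (ω : EuclideanSpace ℂ (Fin m)) (φout : EuclideanSpace ℂ (Fin d)),
    O.Mem Λ ∧ ‖ω‖ = 1 ∧ ‖φout‖ = 1 ∧
    traceA (Λ (proj φ ⊗ₖ proj ω)) = proj ω ∧ traceC (Λ (proj φ ⊗ₖ proj ω)) = proj φout ∧
    purifiedDist (proj φout) (proj (maxCoherent d N)) ≤ ε}

/-- The set of values `log₂ N`, for `N` in `S`. -/
def logSet (S : Set ℕ) : Set ℝ := (fun N : ℕ => Real.logb 2 N) '' S

/-- `C^ε_{O,d}(ρ)`. -/
def C_d (O : OpClass) (ε : ℝ) {d : ℕ} (ρ : Matrix (Fin d) (Fin d) ℂ) : ℝ :=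
  sSup (logSet (distillSet O ε ρ))

/-- `C^ε_{O,pc}(ρ)`. -/
def C_pc (O : OpClass) (ε : ℝ) {d : ℕ} (ρ : Matrix (Fin d) (Fin d) ℂ) : ℝ :=
  sSup (logSet (distillPcSet O ε ρ))

/-- `C̃^ε_{O,d}(φ)`: pure-state smoothing. -/
def Ctilde_d (O : OpClass) (ε : ℝ) {d : ℕ} (φ : EuclideanSpace ℂ (Fin d)) : ℝ :=
  sSup (logSet (pureDistillSet O ε φ))

/-- `C̃^ε_{O,pc}(φ)`: pure-state smoothing. -/
def Ctilde_pc (O : OpClass) (ε : ℝ) {d : ℕ} (φ : EuclideanSpace ℂ (Fin d)) : ℝ :=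
  sSup (logSet (pureDistillPcSet O ε φ))

/-- The number of non-zero coefficients in the incoherent basis. -/
def coherenceRank {d : ℕ} (φ : EuclideanSpace ℂ (Fin d)) : ℕ := Nat.card {i // φ i ≠ 0}

/-- The largest squared modulus of a coefficient. -/
def maxCoeff {d : ℕ} (φ : EuclideanSpace ℂ (Fin d)) : ℝ := ⨆ i, ‖φ i‖ ^ 2

end Coherence

end

noncomputable section

namespace Coherence

/-! Conversion between pure states is governed by majorization of the squared moduli. If a channel
takes `φ` to a pure `χ`, each Kraus operator takes `φ` to a multiple of `χ`. An incoherent one has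
at most one non-zero entry per column, so it carries an index set into a set that is no larger;
averaging over the branches gives `isMajorizedBy_of_kraus`. Conversely, a majorized distribution is
an average of rearrangements, and each rearrangement becomes a monomial Kraus operator, which is
strictly incoherent (`IsMajorizedBy.exists_strictlyIncoherent`). Hence IO and SIO have the same
feasible sets. With a catalyst, pure marginals force the joint output to be `χ ⊗ ω`, so the
criterion becomes majorization of `φ ⊗ ω` by `χ ⊗ ω`.

No catalyst evades two monotones: the largest weight cannot decrease and the rank cannot increase.
For `χ` within `ε` of `Ψ_N`, the first gives `|φ_i|² ≤ 1/N + ε`, and the second gives `N ≤ r` when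
`r(r-1)ε ≤ 1`. These bounds already suffice without a catalyst: `φ` is majorized by a slightly
tilted `Ψ_N` whose squared distance from `Ψ_N` is at most `2(N-1)ε ≤ r(r-1)ε`
(`exists_majorizing_near_maxCoherent`). At `ε = 0` the necessary and the sufficient condition are
both `φ_max ≤ 1/N`, and an output at distance zero from `Ψ_N` is automatically pure. -/

/-! ### Majorization and convex combinations of rearrangements -/

/-- Majorization, stated without sorting: the mass that `p` gives to a set is at most the mass
that `q` gives to some set of at most the same size. -/
def IsMajorizedBy {ι : Type*} (p q : ι → ℝ) : Prop :=
  ∀ S : Finset ι, ∃ T : Finset ι, T.card ≤ S.card ∧ ∑ i ∈ S, p i ≤ ∑ i ∈ T, q i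

/-- Abel summation: the partial sums of `a` get multiplied by the nonnegative drops of `y`. The
boundary term vanishes because the total is zero, so `y` may take either sign. -/
lemma sum_range_mul_nonneg_of_antitone {n : ℕ} (y a : ℕ → ℝ)
    (hy : ∀ i, i + 1 < n → y (i + 1) ≤ y i)
    (ha : ∀ k ≤ n, 0 ≤ ∑ i ∈ Finset.range k, a i) (h0 : ∑ i ∈ Finset.range n, a i = 0) :
    0 ≤ ∑ i ∈ Finset.range n, y i * a i := by
  have key : ∀ k, k + 1 ≤ n →
      y k * ∑ i ∈ Finset.range (k + 1), a i ≤ ∑ i ∈ Finset.range (k + 1), y i * a i := by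
    intro k
    induction k with
    | zero => intro _; simp
    | succ k ih =>
      intro hk
      rw [Finset.sum_range_succ a, Finset.sum_range_succ (fun i => y i * a i), mul_add]
      have h1 := ih (by omega)
      have h2 := mul_le_mul_of_nonneg_right (hy k (by omega)) (ha (k + 1) (by omega))
      linarith
  rcases n with _ | n
  · simp
  · have := key n le_rfl
    rwa [h0, mul_zero] at this

lemma sum_fin_filter_lt {n k : ℕ} (hk : k ≤ n) (f : ℕ → ℝ) :
    ∑ i ∈ Finset.univ.filter (fun i : Fin n => (i : ℕ) < k), f i = ∑ i ∈ Finset.range k, f i := by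
  rw [Finset.sum_filter, Fin.sum_univ_eq_sum_range (fun i => if i < k then f i else 0),
    ← Finset.sum_filter]
  congr 1
  ext i
  simp only [Finset.mem_filter, Finset.mem_range]
  omega

lemma card_fin_filter_lt {n k : ℕ} (hk : k ≤ n) :
    (Finset.univ.filter fun i : Fin n => (i : ℕ) < k).card = k := by
  have h := sum_fin_filter_lt hk (fun _ => (1 : ℝ))
  simp only [Finset.sum_const, Finset.card_range, nsmul_eq_mul, mul_one] at h
  exact_mod_cast h

/-- Among the sets of at most `k` indices, the first `k` indices have the largest sum of an
antitone nonnegative sequence. -/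
lemma sum_le_sum_filter_lt {n k : ℕ} (hk : k ≤ n) (q : Fin n → ℝ) (hq : Antitone q)
    (hq0 : ∀ i, 0 ≤ q i) (T : Finset (Fin n)) (hT : T.card ≤ k) :
    ∑ i ∈ T, q i ≤ ∑ i ∈ Finset.univ.filter (fun i : Fin n => (i : ℕ) < k), q i := by
  rcases k with _ | k
  · have : T = ∅ := by simpa using hT
    simp [this]
  set F := Finset.univ.filter fun i : Fin n => (i : ℕ) < k + 1 with hF
  -- The smallest of the first `k + 1` values: `q i - c` is nonnegative on `F` and nonpositive off
  -- it. Since `c ≥ 0`, a smaller `T` does no harm.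
  set c := q ⟨k, hk⟩
  have h1 : ∑ i ∈ T, (q i - c) ≤ ∑ i ∈ F, (q i - c) := by
    calc ∑ i ∈ T, (q i - c) ≤ ∑ i ∈ T, (if (i : ℕ) < k + 1 then q i - c else 0) := by
          refine Finset.sum_le_sum fun i _ => ?_
          split_ifs with h
          · exact le_rfl
          · have : q i ≤ c := hq (by rw [Fin.le_def]; simp; omega)
            linarith
      _ ≤ ∑ i : Fin n, (if (i : ℕ) < k + 1 then q i - c else 0) := by
          refine Finset.sum_le_sum_of_subset_of_nonneg (Finset.subset_univ _) fun i _ _ => ?_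
          split_ifs with h
          · have : c ≤ q i := hq (by rw [Fin.le_def]; simp; omega)
            linarith
          · exact le_rfl
      _ = _ := by rw [hF, Finset.sum_filter]
  have h2 : F.card = k + 1 := card_fin_filter_lt hk
  have h3 : (T.card : ℝ) * c ≤ (F.card : ℝ) * c :=
    mul_le_mul_of_nonneg_right (by rw [h2]; exact_mod_cast hT) (hq0 _)
  simp only [Finset.sum_sub_distrib, Finset.sum_const, nsmul_eq_mul] at h1
  linarith

lemma exists_equiv_fin_antitone {ι : Type*} [Fintype ι] (y : ι → ℝ) :
    ∃ e : Fin (Fintype.card ι) ≃ ι, Antitone (y ∘ e) := by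
  let e := (Fintype.equivFin ι).symm
  refine ⟨(Tuple.sort fun i => - y (e i)).trans e, fun i j hij => ?_⟩
  have := Tuple.monotone_sort (fun i => - y (e i)) hij
  simpa using this

/-- A rearrangement inequality: pairing the largest entries of `q` with the largest of `y` beats
`p`. This compares a linear functional at `p` with its values at the rearrangements of `q`, as the
separation argument below requires. -/
lemma IsMajorizedBy.exists_perm_sum_mul_le {ι : Type*} [Fintype ι] {p q : ι → ℝ}
    (h : IsMajorizedBy p q) (hq0 : ∀ i, 0 ≤ q i) (hs : ∑ i, p i = ∑ i, q i) (y : ι → ℝ) :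
    ∃ π : Equiv.Perm ι, ∑ i, y i * p i ≤ ∑ i, y i * q (π i) := by
  classical
  set n := Fintype.card ι
  obtain ⟨e, he⟩ : ∃ e : Fin n ≃ ι, Antitone (y ∘ e) := exists_equiv_fin_antitone y
  obtain ⟨g, hg⟩ : ∃ g : Fin n ≃ ι, Antitone (q ∘ g) := exists_equiv_fin_antitone q
  refine ⟨e.symm.trans g, ?_⟩
  let ext (f : Fin n → ℝ) (i : ℕ) : ℝ := if hi : i < n then f ⟨i, hi⟩ else 0
  have hext : ∀ f (i : Fin n), ext f i = f i := fun f i => by simp [ext]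
  -- Here `p` is listed in the order that sorts `y`, not its own. Majorization bounds its mass on
  -- every set, so the partial sums of `a` are still nonnegative.
  let a : Fin n → ℝ := fun i => q (g i) - p (e i)
  have hpart : ∀ k ≤ n, 0 ≤ ∑ i ∈ Finset.range k, ext a i := by
    intro k hk
    rw [← sum_fin_filter_lt hk]
    simp only [hext, a, Finset.sum_sub_distrib, sub_nonneg]
    obtain ⟨T, hT, hle⟩ := h ((Finset.univ.filter fun i : Fin n => (i : ℕ) < k).map e.toEmbedding)
    rw [Finset.card_map, card_fin_filter_lt hk] at hT
    rw [Finset.sum_map] at hle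
    refine hle.trans ?_
    have := sum_le_sum_filter_lt hk (q ∘ g) hg (fun i => hq0 _) (T.map g.symm.toEmbedding)
      (by simpa using hT)
    simpa [Finset.sum_map] using this
  have hzero : ∑ i ∈ Finset.range n, ext a i = 0 := by
    rw [← Fin.sum_univ_eq_sum_range]
    simp only [hext, a, Finset.sum_sub_distrib]
    rw [g.sum_comp q, e.sum_comp p, hs, sub_self]
  have hmain := sum_range_mul_nonneg_of_antitone (ext (y ∘ e)) (ext a)
    (fun i hi => by
      have := he (show (⟨i, by omega⟩ : Fin n) ≤ ⟨i + 1, hi⟩ by simp)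
      simpa [ext, hi, show i < n by omega] using this) hpart hzero
  rw [← Fin.sum_univ_eq_sum_range (fun i => ext (y ∘ e) i * ext a i)] at hmain
  simp only [hext, a, mul_sub, Finset.sum_sub_distrib, sub_nonneg, Function.comp] at hmain
  rw [← e.sum_comp, ← e.sum_comp (fun i => y i * q _)]
  simpa using hmain

/-- A vector majorized by `q` is a convex combination of rearrangements of `q`. -/
theorem IsMajorizedBy.mem_convexHull {ι : Type*} [Fintype ι] {p q : ι → ℝ}
    (h : IsMajorizedBy p q) (hq0 : ∀ i, 0 ≤ q i) (hs : ∑ i, p i = ∑ i, q i) :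
    p ∈ convexHull ℝ (Set.range fun π : Equiv.Perm ι => q ∘ π) := by
  classical
  by_contra hp
  have hcl : IsClosed (convexHull ℝ (Set.range fun π : Equiv.Perm ι => q ∘ π)) :=
    (Set.finite_range _).isClosed_convexHull ℝ
  obtain ⟨f, u, hfu, hup⟩ := geometric_hahn_banach_closed_point (convex_convexHull ℝ _) hcl hp
  have hf : ∀ v : ι → ℝ, f v = ∑ i, f (Pi.single i 1) * v i := fun v => by
    conv_lhs => rw [pi_eq_sum_univ' v, map_sum]
    refine Finset.sum_congr rfl fun i _ => ?_
    rw [map_smul, smul_eq_mul, mul_comm]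
  obtain ⟨π, hπ⟩ := h.exists_perm_sum_mul_le hq0 hs fun i => f (Pi.single i 1)
  have h1 := hfu (q ∘ π) (subset_convexHull ℝ _ ⟨π, rfl⟩)
  rw [hf] at h1 hup
  simp only [Function.comp] at h1
  linarith

lemma IsMajorizedBy.exists_weights {ι : Type*} [Fintype ι] {p q : ι → ℝ}
    (h : IsMajorizedBy p q) (hq0 : ∀ i, 0 ≤ q i) (hs : ∑ i, p i = ∑ i, q i) :
    ∃ (k : ℕ) (w : Fin k → ℝ) (π : Fin k → Equiv.Perm ι), (∀ n, 0 ≤ w n) ∧ ∑ n, w n = 1 ∧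
      ∀ i, ∑ n, w n * q (π n i) = p i := by
  obtain ⟨κ, _, w, z, hw0, hw1, hz, hx⟩ :=
    mem_convexHull_iff_exists_fintype.1 (h.mem_convexHull hq0 hs)
  choose π hπ using hz
  let e := (Fintype.equivFin κ).symm
  refine ⟨Fintype.card κ, w ∘ e, π ∘ e, fun n => hw0 _, ?_, fun i => ?_⟩
  · rw [← hw1]; exact e.sum_comp w
  · rw [← hx, Finset.sum_apply]
    refine (e.sum_comp fun n => w n * q (π n i)).trans (Finset.sum_congr rfl fun n _ => ?_)
    rw [← hπ n]; rfl

/-! ### Pure states and their trivial decompositions -/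

section PureStates

variable {ι : Type} [Fintype ι] [DecidableEq ι]

/-- The distribution of the squared moduli of the coefficients. -/
def coeffDist {ι : Type} [Fintype ι] (ψ : EuclideanSpace ℂ ι) (i : ι) : ℝ := ‖ψ i‖ ^ 2

lemma coeffDist_nonneg {ι : Type} [Fintype ι] (ψ : EuclideanSpace ℂ ι) (i : ι) :
    0 ≤ coeffDist ψ i := sq_nonneg _

lemma sum_coeffDist {ι : Type} [Fintype ι] {ψ : EuclideanSpace ℂ ι} (hψ : ‖ψ‖ = 1) :
    ∑ i, coeffDist ψ i = 1 := by
  have := EuclideanSpace.norm_sq_eq ψ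
  rw [hψ] at this
  simpa [coeffDist] using this.symm

lemma proj_apply {ι : Type} [Fintype ι] (ψ : EuclideanSpace ℂ ι) (i j : ι) :
    proj ψ i j = ψ i * star (ψ j) := rfl

lemma proj_smul {ι : Type} [Fintype ι] (c : ℂ) (ψ : EuclideanSpace ℂ ι) :
    proj (c • ψ) = (c * star c) • proj ψ := by
  ext i j
  simp only [proj_apply, PiLp.smul_apply, Matrix.smul_apply, smul_eq_mul, star_mul']
  ring

lemma mul_proj_mul_conjTranspose {ι κ : Type} [Fintype ι] [Fintype κ] (K : Matrix κ ι ℂ)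
    (ψ : EuclideanSpace ℂ ι) :
    K * proj ψ * K.conjTranspose = proj (WithLp.toLp 2 (K.mulVec ψ)) := by
  have h : ∀ {α : Type} [Fintype α] (v : EuclideanSpace ℂ α),
      proj v = Matrix.vecMulVec (WithLp.ofLp v) (star (WithLp.ofLp v)) := fun v => rfl
  rw [h, h, Matrix.mul_vecMulVec, Matrix.vecMulVec_mul, Matrix.star_mulVec]

lemma trace_proj {ι : Type} [Fintype ι] (ψ : EuclideanSpace ℂ ι) :
    (proj ψ).trace = ((‖ψ‖ ^ 2 : ℝ) : ℂ) := by
  rw [EuclideanSpace.norm_sq_eq, Matrix.trace]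
  push_cast
  refine Finset.sum_congr rfl fun i _ => ?_
  rw [Matrix.diag_apply, proj_apply]
  exact Complex.mul_conj' _

lemma inner_eq_dotProduct {ι : Type} [Fintype ι] (ψ v : EuclideanSpace ℂ ι) :
    inner ℂ ψ v = star (WithLp.ofLp ψ) ⬝ᵥ WithLp.ofLp v := by
  rw [EuclideanSpace.inner_eq_star_dotProduct, dotProduct_comm]

lemma star_dotProduct_proj_mulVec {ι : Type} [Fintype ι] (ψ v : EuclideanSpace ℂ ι) :
    star (WithLp.ofLp ψ) ⬝ᵥ (proj v).mulVec ψ = ((‖inner ℂ ψ v‖ ^ 2 : ℝ) : ℂ) := by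
  have h : proj v = Matrix.vecMulVec (WithLp.ofLp v) (star (WithLp.ofLp v)) := rfl
  rw [h, Matrix.vecMulVec_mulVec, dotProduct_smul, ← inner_eq_dotProduct, ← inner_eq_dotProduct,
    ← inner_conj_symm v ψ]
  simp only [MulOpposite.smul_eq_mul_unop, MulOpposite.unop_op]
  rw [Complex.mul_conj']
  norm_cast

lemma norm_sub_inner_smul_sq {ι : Type} [Fintype ι] {ψ : EuclideanSpace ℂ ι} (hψ : ‖ψ‖ = 1)
    (v : EuclideanSpace ℂ ι) :
    ‖v - (inner ℂ ψ v : ℂ) • ψ‖ ^ 2 = ‖v‖ ^ 2 - ‖(inner ℂ ψ v : ℂ)‖ ^ 2 := by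
  rw [@norm_sub_sq ℂ, inner_smul_right, norm_smul, hψ, ← inner_conj_symm v ψ, Complex.mul_conj']
  have : RCLike.re ((‖(inner ℂ ψ v : ℂ)‖ : ℂ) ^ 2) = ‖(inner ℂ ψ v : ℂ)‖ ^ 2 := by
    rw [← Complex.ofReal_pow]
    exact Complex.ofReal_re _
  rw [this, mul_one]
  ring

/-- If the state `∑ n, |v n⟩⟨v n|` has all its weight on `ψ`, then every `v n` is a multiple
of `ψ`. -/
lemma eq_smul_of_trace_le {ι : Type} [Fintype ι] {κ : Type*} [Fintype κ]
    (v : κ → EuclideanSpace ℂ ι) {ψ : EuclideanSpace ℂ ι} (hψ : ‖ψ‖ = 1)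
    {ρ : Matrix ι ι ℂ} (hρ : ∑ n, proj (v n) = ρ)
    (h : ρ.trace.re ≤ (star (WithLp.ofLp ψ) ⬝ᵥ ρ.mulVec ψ).re) (n : κ) :
    v n = (inner ℂ ψ (v n) : ℂ) • ψ := by
  rw [← hρ, Matrix.trace_sum, Matrix.sum_mulVec, dotProduct_sum] at h
  simp only [trace_proj, star_dotProduct_proj_mulVec, ← Complex.ofReal_sum,
    Complex.ofReal_re] at h
  have h3 : ∑ n, ‖v n - (inner ℂ ψ (v n) : ℂ) • ψ‖ ^ 2 = 0 := by
    refine le_antisymm ?_ (Finset.sum_nonneg fun n _ => sq_nonneg _)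
    simp only [norm_sub_inner_smul_sq hψ, Finset.sum_sub_distrib]
    linarith
  have h4 := (Finset.sum_eq_zero_iff_of_nonneg fun i _ => sq_nonneg _).1 h3 n (Finset.mem_univ n)
  exact sub_eq_zero.1 (norm_eq_zero.1 (pow_eq_zero_iff two_ne_zero |>.1 h4))

/-- A decomposition of a pure state into pure states is trivial. -/
lemma eq_smul_of_sum_proj {ι : Type} [Fintype ι] {κ : Type*} [Fintype κ]
    (v : κ → EuclideanSpace ℂ ι) {ψ : EuclideanSpace ℂ ι} (hψ : ‖ψ‖ = 1)
    (h : ∑ n, proj (v n) = proj ψ) (n : κ) : v n = (inner ℂ ψ (v n) : ℂ) • ψ := by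
  refine eq_smul_of_trace_le v hψ h ?_ n
  rw [trace_proj, star_dotProduct_proj_mulVec, inner_self_eq_norm_sq_to_K, hψ]
  simp

/-! ### Incoherent operations force majorization -/

lemma isIncoherentState_single (j : ι) :
    IsIncoherentState (Matrix.diagonal fun i => ((Pi.single j 1 : ι → ℝ) i : ℂ)) :=
  ⟨Pi.single j 1, fun i => by by_cases h : i = j <;> simp [h],
    by simp [Pi.single_apply], rfl⟩

/-- An incoherent-preserving operator has at most one non-zero entry in each column. -/
lemma IsIncoherentPreserving.eq_of_ne_zero {K : Matrix ι ι ℂ} (hK : IsIncoherentPreserving K)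
    {i i' j : ι} (h : K i j ≠ 0) (h' : K i' j ≠ 0) : i = i' := by
  by_contra hne
  have hentry : ∀ a b, (K * (Matrix.diagonal fun i => ((Pi.single j 1 : ι → ℝ) i : ℂ)) *
      K.conjTranspose) a b = K a j * star (K b j) := by
    intro a b
    rw [Matrix.mul_apply, Finset.sum_eq_single j]
    · simp
    · intro l _ hl; simp [Pi.single_apply, hl]
    · simp
  have htr : (K * (Matrix.diagonal fun i => ((Pi.single j 1 : ι → ℝ) i : ℂ)) *
      K.conjTranspose).trace ≠ 0 := by
    rw [Matrix.trace]
    simp only [Matrix.diag_apply, hentry]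
    intro h0
    have h1 : ∑ a, ‖K a j‖ ^ 2 = 0 := by
      have h2 : ((∑ a, ‖K a j‖ ^ 2 : ℝ) : ℂ) = 0 := by
        rw [← h0]
        push_cast
        exact Finset.sum_congr rfl fun a _ => (Complex.mul_conj' _).symm
      exact_mod_cast h2
    have := (Finset.sum_eq_zero_iff_of_nonneg fun i _ => sq_nonneg _).1 h1 i (Finset.mem_univ i)
    exact h (by simpa using this)
  obtain ⟨p, -, -, hp⟩ := hK _ (isIncoherentState_single j) htr
  have := congrFun (congrFun hp i) i'
  rw [Matrix.smul_apply, hentry, Matrix.diagonal_apply_ne _ hne] at this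
  simp [htr, h, h'] at this

lemma sum_star_mulVec_dotProduct_mulVec {k : ℕ} {K : Fin k → Matrix ι ι ℂ}
    (hK : ∑ n, (K n).conjTranspose * K n = 1) (x y : ι → ℂ) :
    ∑ n, star ((K n).mulVec x) ⬝ᵥ (K n).mulVec y = star x ⬝ᵥ y := by
  have : ∀ n, star ((K n).mulVec x) ⬝ᵥ (K n).mulVec y =
      star x ⬝ᵥ ((K n).conjTranspose * K n).mulVec y := fun n => by
    rw [Matrix.star_mulVec, ← Matrix.mulVec_mulVec, Matrix.dotProduct_mulVec (star x)]
  simp only [this]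
  rw [← dotProduct_sum, ← Matrix.sum_mulVec, hK, Matrix.one_mulVec]

/-- An incoherent operation that turns `φ` into `χ` on every branch forces majorization. -/
theorem isMajorizedBy_of_kraus {k : ℕ} {K : Fin k → Matrix ι ι ℂ}
    (hK : ∑ n, (K n).conjTranspose * K n = 1) (hI : ∀ n, IsIncoherentPreserving (K n))
    {φ χ : EuclideanSpace ℂ ι} (hφ : ‖φ‖ = 1) (hχ : ‖χ‖ = 1) (b : Fin k → ℂ)
    (hb : ∀ n, (K n).mulVec φ = b n • WithLp.ofLp χ) :
    IsMajorizedBy (coeffDist φ) (coeffDist χ) := by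
  intro S
  have hf : ∀ n j, ∃ i, ∀ i', K n i' j ≠ 0 → i' = i := by
    intro n j
    by_cases h : ∃ i, K n i j ≠ 0
    · obtain ⟨i, hi⟩ := h
      exact ⟨i, fun i' hi' => (hI n).eq_of_ne_zero hi' hi⟩
    · push Not at h
      exact ⟨j, fun i' hi' => absurd (h i') hi'⟩
  choose f hf using hf
  let T : Fin k → Finset ι := fun n => S.image (f n)
  have hT : ∀ n, (T n).card ≤ S.card := fun n => Finset.card_image_le
  -- The part of `φ` on `S`; its image under `K n` lives on `T n`. The remainder `y` may also reach
  -- `T n`, but its cross terms with `x` cancel in the sum over branches.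
  let x : ι → ℂ := fun j => if j ∈ S then φ j else 0
  let y : ι → ℂ := fun j => if j ∈ S then 0 else φ j
  have hxy : WithLp.ofLp φ = x + y := by
    ext j
    by_cases h : j ∈ S <;> simp [x, y, h]
  have hx0 : ∀ n, ∀ i ∉ T n, (K n).mulVec x i = 0 := by
    intro n i hi
    refine Finset.sum_eq_zero fun j _ => ?_
    by_cases hj : j ∈ S
    · have : K n i j = 0 := by
        by_contra h
        exact hi (Finset.mem_image.2 ⟨j, hj, (hf n j i h).symm⟩)
      simp [this]
    · simp [x, hj]
  have hbsum : ∑ n, ‖b n‖ ^ 2 = 1 := by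
    have h1 := sum_star_mulVec_dotProduct_mulVec hK φ φ
    simp only [hb, star_smul, smul_dotProduct, dotProduct_smul, ← inner_eq_dotProduct,
      inner_self_eq_norm_sq_to_K, hχ, hφ] at h1
    have h2 : ((∑ n, ‖b n‖ ^ 2 : ℝ) : ℂ) = 1 := by
      push_cast
      simp only [← Complex.mul_conj']
      simpa using h1
    exact_mod_cast h2
  have hbranch : ∀ n, (star ((K n).mulVec x) ⬝ᵥ (K n).mulVec x).re +
      2 * (star ((K n).mulVec x) ⬝ᵥ (K n).mulVec y).re ≤
        ‖b n‖ ^ 2 * ∑ i ∈ T n, coeffDist χ i := by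
    intro n
    have hpt : ∀ i, ‖b n‖ ^ 2 * coeffDist χ i = ‖(K n).mulVec x i + (K n).mulVec y i‖ ^ 2 := by
      intro i
      rw [← Pi.add_apply, ← Matrix.mulVec_add, ← hxy, hb]
      simp [coeffDist, mul_pow]
    rw [Finset.mul_sum, Finset.sum_congr rfl fun i _ => hpt i, dotProduct, dotProduct,
      Complex.re_sum, Complex.re_sum, Finset.mul_sum, ← Finset.sum_add_distrib,
      ← Finset.sum_subset (Finset.subset_univ (T n))
        (fun i _ hi => by simp [hx0 n i hi])]
    refine Finset.sum_le_sum fun i _ => ?_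
    simp only [Pi.star_apply, Complex.star_def, Complex.sq_norm, Complex.normSq_apply,
      Complex.add_re, Complex.add_im, Complex.mul_re, Complex.conj_re, Complex.conj_im]
    -- Expand `|u + v|²` and discard `|v|²`.
    nlinarith [sq_nonneg ((K n).mulVec y i).re, sq_nonneg ((K n).mulVec y i).im]
  have hsum : ∑ i ∈ S, coeffDist φ i ≤ ∑ n, ‖b n‖ ^ 2 * ∑ i ∈ T n, coeffDist χ i := by
    refine le_trans (le_of_eq ?_) (Finset.sum_le_sum fun n _ => hbranch n)
    rw [Finset.sum_add_distrib, ← Finset.mul_sum, ← Complex.re_sum, ← Complex.re_sum,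
      sum_star_mulVec_dotProduct_mulVec hK, sum_star_mulVec_dotProduct_mulVec hK]
    have h0 : star x ⬝ᵥ y = 0 :=
      Finset.sum_eq_zero fun j _ => by by_cases h : j ∈ S <;> simp [x, y, h]
    rw [h0, dotProduct, Complex.re_sum, ← Finset.sum_subset (Finset.subset_univ S)
      (fun i _ hi => by simp [x, hi])]
    simp only [Complex.zero_re, mul_zero, add_zero]
    refine Finset.sum_congr rfl fun j hj => ?_
    simp [x, hj, coeffDist, Complex.sq_norm, Complex.normSq_apply]
  -- The mass of `S` is at most a weighted average of the masses of the `T n`, so some `T n` has at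
  -- least that mass.
  by_contra hcon
  push Not at hcon
  have hlt : ∀ n, ∑ i ∈ T n, coeffDist χ i < ∑ i ∈ S, coeffDist φ i := fun n => hcon _ (hT n)
  obtain ⟨n, hn⟩ : ∃ n, 0 < ‖b n‖ ^ 2 := by
    by_contra h
    push Not at h
    have := Finset.sum_nonpos fun n (_ : n ∈ Finset.univ) => h n
    linarith
  have : ∑ n, ‖b n‖ ^ 2 * ∑ i ∈ T n, coeffDist χ i <
      ∑ n, ‖b n‖ ^ 2 * ∑ i ∈ S, coeffDist φ i :=
    Finset.sum_lt_sum (fun n _ => mul_le_mul_of_nonneg_left (hlt n).le (sq_nonneg _))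
      ⟨n, Finset.mem_univ n, mul_lt_mul_of_pos_left (hlt n) hn⟩
  rw [← Finset.sum_mul, hbsum, one_mul] at this
  linarith

/-! ### Monomial Kraus operators and the converse -/

/-- The matrix that sends `|j⟩` to `c j |π j⟩`. -/
def monomialMatrix {ι : Type} [DecidableEq ι] (π : Equiv.Perm ι) (c : ι → ℂ) : Matrix ι ι ℂ :=
  Matrix.of fun i j => if i = π j then c j else 0

lemma conjTranspose_monomialMatrix {ι : Type} [DecidableEq ι] (π : Equiv.Perm ι) (c : ι → ℂ) :
    (monomialMatrix π c).conjTranspose =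
      monomialMatrix π.symm fun i => star (c (π.symm i)) := by
  ext i j
  simp only [monomialMatrix, Matrix.conjTranspose_apply, Matrix.of_apply]
  by_cases h : j = π i
  · subst h; simp
  · rw [if_neg h, if_neg (fun h' => h (by simp [h'])), star_zero]

lemma monomialMatrix_mul_diagonal_mul (π : Equiv.Perm ι) (c e : ι → ℂ) :
    monomialMatrix π c * Matrix.diagonal e * (monomialMatrix π c).conjTranspose =
      Matrix.diagonal fun i => c (π.symm i) * e (π.symm i) * star (c (π.symm i)) := by
  ext i j
  rw [Matrix.mul_apply, Finset.sum_eq_single (π.symm i)]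
  · by_cases h : i = j
    · subst h; simp [monomialMatrix]
    · simp [monomialMatrix, h, Ne.symm h]
  · intro l _ hl
    have : i ≠ π l := fun h => hl (by simp [h])
    simp [monomialMatrix, this]
  · simp

lemma isIncoherentPreserving_monomialMatrix (π : Equiv.Perm ι) (c : ι → ℂ) :
    IsIncoherentPreserving (monomialMatrix π c) := by
  rintro _ ⟨p, hp0, -, rfl⟩ htr
  rw [monomialMatrix_mul_diagonal_mul] at htr ⊢
  have hterm : ∀ i, c (π.symm i) * (p (π.symm i) : ℂ) * star (c (π.symm i)) =
      ((‖c (π.symm i)‖ ^ 2 * p (π.symm i) : ℝ) : ℂ) := by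
    intro i
    rw [mul_right_comm]
    push_cast
    rw [← Complex.mul_conj']
    rfl
  simp only [hterm, Matrix.trace_diagonal] at htr ⊢
  rw [← Complex.ofReal_sum] at htr ⊢
  set t := ∑ i, ‖c (π.symm i)‖ ^ 2 * p (π.symm i)
  have ht : t ≠ 0 := by exact_mod_cast htr
  have ht0 : 0 ≤ t := Finset.sum_nonneg fun i _ => mul_nonneg (sq_nonneg _) (hp0 _)
  refine ⟨fun i => t⁻¹ * (‖c (π.symm i)‖ ^ 2 * p (π.symm i)), fun i =>
    mul_nonneg (inv_nonneg.2 ht0) (mul_nonneg (sq_nonneg _) (hp0 _)), ?_, ?_⟩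
  · rw [← Finset.mul_sum]
    exact inv_mul_cancel₀ ht
  · rw [← Matrix.diagonal_smul]
    congr 1
    ext i
    simp

lemma conjTranspose_mul_monomialMatrix (π : Equiv.Perm ι) (c : ι → ℂ) :
    (monomialMatrix π c).conjTranspose * monomialMatrix π c =
      Matrix.diagonal fun i => ((‖c i‖ ^ 2 : ℝ) : ℂ) := by
  have := monomialMatrix_mul_diagonal_mul π.symm (fun i => star (c (π.symm i))) 1
  rw [← conjTranspose_monomialMatrix, Matrix.conjTranspose_conjTranspose] at this
  rw [show Matrix.diagonal (1 : ι → ℂ) = 1 from Matrix.diagonal_one, mul_one] at this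
  rw [this]
  congr 1
  ext i
  simp [Complex.conj_mul']

lemma monomialMatrix_mulVec (π : Equiv.Perm ι) (c v : ι → ℂ) (i : ι) :
    (monomialMatrix π c).mulVec v (π i) = c i * v i := by
  rw [Matrix.mulVec, dotProduct, Finset.sum_eq_single i]
  · simp [monomialMatrix]
  · intro j _ hj
    simp [monomialMatrix, Ne.symm hj]
  · simp

lemma OpClass.Mem.incoherent {O : OpClass} {Λ : Matrix ι ι ℂ → Matrix ι ι ℂ} (h : O.Mem Λ) :
    OpClass.incoherent.Mem Λ := by
  cases O with
  | incoherent => exact h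
  | strictlyIncoherent =>
    obtain ⟨k, K, hK, hI⟩ := h
    exact ⟨k, K, hK, fun n => (hI n).1⟩

lemma OpClass.Mem.of_strictlyIncoherent (O : OpClass) {Λ : Matrix ι ι ℂ → Matrix ι ι ℂ}
    (h : OpClass.strictlyIncoherent.Mem Λ) : O.Mem Λ := by
  cases O with
  | incoherent => exact h.incoherent
  | strictlyIncoherent => exact h

/-- Majorization suffices for a strictly incoherent conversion of pure states. -/
theorem IsMajorizedBy.exists_strictlyIncoherent {φ χ : EuclideanSpace ℂ ι}
    (h : IsMajorizedBy (coeffDist φ) (coeffDist χ)) (hφ : ‖φ‖ = 1) (hχ : ‖χ‖ = 1) :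
    ∃ Λ : Matrix ι ι ℂ → Matrix ι ι ℂ,
      OpClass.strictlyIncoherent.Mem Λ ∧ Λ (proj φ) = proj χ := by
  obtain ⟨k, w, π, hw0, hw1, hw⟩ := h.exists_weights (coeffDist_nonneg χ)
    (by rw [sum_coeffDist hφ, sum_coeffDist hχ])
  -- Chosen so that `K n` takes `φ` to `√(w n) χ`; completeness is then the convex decomposition
  -- divided by `|φ i|²`. Where `φ i = 0`, the factor `1` keeps the column normalized.
  let c : Fin k → ι → ℂ := fun n i =>
    (Real.sqrt (w n) : ℂ) * if φ i = 0 then 1 else χ (π n i) / φ i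
  let K : Fin k → Matrix ι ι ℂ := fun n => monomialMatrix (π n) (c n)
  have hsq : ∀ n, ‖(Real.sqrt (w n) : ℂ)‖ ^ 2 = w n := fun n => by
    rw [Complex.norm_real, Real.norm_eq_abs, sq_abs, Real.sq_sqrt (hw0 n)]
  have hc : ∀ n i, ‖c n i‖ ^ 2 = if φ i = 0 then w n else
      w n * coeffDist χ (π n i) / coeffDist φ i := by
    intro n i
    simp only [c, norm_mul, mul_pow, hsq]
    split_ifs with h0
    · simp
    · rw [norm_div, div_pow, mul_div_assoc]; rfl
  refine ⟨fun X => ∑ n, K n * X * (K n).conjTranspose,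
    ⟨k, K, ⟨?_, fun X => rfl⟩, fun n => ⟨isIncoherentPreserving_monomialMatrix _ _, ?_⟩⟩, ?_⟩
  · simp only [K, conjTranspose_mul_monomialMatrix]
    ext i j
    rw [Matrix.sum_apply]
    by_cases hij : i = j
    · subst hij
      simp only [Matrix.diagonal_apply_eq, Matrix.one_apply_eq]
      rw [← Complex.ofReal_sum, ← Complex.ofReal_one]
      congr 1
      simp only [hc]
      split_ifs with h0
      · exact hw1
      · rw [← Finset.sum_div, hw]
        exact div_self (pow_ne_zero 2 (norm_ne_zero_iff.2 h0))
    · simp [hij]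
  · rw [conjTranspose_monomialMatrix]
    exact isIncoherentPreserving_monomialMatrix _ _
  · have hKφ : ∀ n, (WithLp.toLp 2 ((K n).mulVec φ) : EuclideanSpace ℂ ι) =
        (Real.sqrt (w n) : ℂ) • χ := by
      intro n
      ext i
      obtain ⟨j, rfl⟩ := (π n).surjective i
      simp only [K, monomialMatrix_mulVec, PiLp.smul_apply, smul_eq_mul, c]
      split_ifs with h0
      · have h1 : coeffDist φ j = 0 := by simp [coeffDist, h0]
        -- A vanishing average of nonnegative terms has vanishing terms, so the target entry `√(w n)
        -- χ (π n j)` is zero too.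
        have h2 := (Finset.sum_eq_zero_iff_of_nonneg fun n _ =>
          mul_nonneg (hw0 n) (coeffDist_nonneg χ _)).1 ((hw j).trans h1) n (Finset.mem_univ n)
        rw [h0, mul_zero]
        rcases mul_eq_zero.1 h2 with h3 | h3
        · simp [h3]
        · have : χ (π n j) = 0 := by simpa [coeffDist] using h3
          simp [this]
      · field_simp
    simp only [mul_proj_mul_conjTranspose, hKφ, proj_smul]
    rw [← Finset.sum_smul]
    have : ∀ n, (Real.sqrt (w n) : ℂ) * star (Real.sqrt (w n) : ℂ) = (w n : ℂ) := fun n => by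
      rw [Complex.star_def, Complex.mul_conj', ← Complex.ofReal_pow, hsq]
    simp only [this]
    rw [← Complex.ofReal_sum, hw1, Complex.ofReal_one, one_smul]

/-! ### Fidelity and purified distance to a pure state -/

lemma posSemidef_proj {ι : Type} [Fintype ι] (ψ : EuclideanSpace ℂ ι) : (proj ψ).PosSemidef :=
  Matrix.posSemidef_vecMulVec_self_star (WithLp.ofLp ψ)

lemma isState_proj {ι : Type} [Fintype ι] {ψ : EuclideanSpace ℂ ι} (hψ : ‖ψ‖ = 1) :
    IsState (proj ψ) :=
  ⟨posSemidef_proj ψ, by rw [trace_proj, hψ]; simp⟩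

lemma proj_mul_proj_self {ι : Type} [Fintype ι] (ψ : EuclideanSpace ℂ ι) :
    proj ψ * proj ψ = ((‖ψ‖ ^ 2 : ℝ) : ℂ) • proj ψ := by
  have h : proj ψ = Matrix.vecMulVec (WithLp.ofLp ψ) (star (WithLp.ofLp ψ)) := rfl
  rw [h, Matrix.vecMulVec_mul_vecMulVec, ← inner_eq_dotProduct, inner_self_eq_norm_sq_to_K]
  ext i j
  simp [Matrix.vecMulVec_apply]
  ring

lemma sqrt_proj (ψ : EuclideanSpace ℂ ι) :
    CFC.sqrt (proj ψ) = ((‖ψ‖⁻¹ : ℝ) : ℂ) • proj ψ := by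
  refine CFC.sqrt_unique ?_ ?_
  · rw [smul_mul_smul_comm, proj_mul_proj_self, smul_smul]
    by_cases h : ψ = 0
    · subst h
      ext i j
      simp [proj_apply]
    · have h' : ‖ψ‖ ≠ 0 := norm_ne_zero_iff.2 h
      rw [← Complex.ofReal_mul, ← Complex.ofReal_mul,
        show ‖ψ‖⁻¹ * ‖ψ‖⁻¹ * ‖ψ‖ ^ 2 = 1 by field_simp, Complex.ofReal_one, one_smul]
  · rw [Matrix.nonneg_iff_posSemidef]
    refine (posSemidef_proj ψ).smul ?_
    exact_mod_cast inv_nonneg.2 (norm_nonneg ψ)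

lemma conjTranspose_sqrt (ρ : Matrix ι ι ℂ) :
    (CFC.sqrt ρ).conjTranspose = CFC.sqrt ρ :=
  (Matrix.nonneg_iff_posSemidef.1 (CFC.sqrt_nonneg ρ)).isHermitian

/-- Sandwiching `|ψ⟩⟨ψ|` between `√ρ` gives the rank-one operator of `√ρ ψ`, whose square root has
trace `‖√ρ ψ‖`. -/
lemma fidelity_proj_right (ρ : Matrix ι ι ℂ) (ψ : EuclideanSpace ℂ ι) :
    fidelity ρ (proj ψ) =
      ‖(WithLp.toLp 2 ((CFC.sqrt ρ).mulVec ψ) : EuclideanSpace ℂ ι)‖ := by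
  have h := mul_proj_mul_conjTranspose (CFC.sqrt ρ) ψ
  rw [conjTranspose_sqrt] at h
  rw [fidelity, h, sqrt_proj, Matrix.trace_smul, trace_proj, smul_eq_mul, ← Complex.ofReal_mul,
    Complex.ofReal_re]
  set t := ‖(WithLp.toLp 2 ((CFC.sqrt ρ).mulVec ψ) : EuclideanSpace ℂ ι)‖
  by_cases h0 : t = 0
  · simp [h0]
  · field_simp

/-- The squared fidelity with a pure state `ψ` is `⟨ψ|ρ|ψ⟩`. -/
lemma fidelity_proj_right_sq {ρ : Matrix ι ι ℂ} (hρ : ρ.PosSemidef) (ψ : EuclideanSpace ℂ ι) :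
    fidelity ρ (proj ψ) ^ 2 = (star (WithLp.ofLp ψ) ⬝ᵥ ρ.mulVec ψ).re := by
  set B := CFC.sqrt ρ with hB
  have h : ρ = B.conjTranspose * B := by
    rw [hB, conjTranspose_sqrt, CFC.sqrt_mul_sqrt_self ρ hρ.nonneg]
  rw [fidelity_proj_right, ← hB]
  conv_rhs => rw [h]
  rw [← Matrix.mulVec_mulVec, Matrix.dotProduct_mulVec, ← Matrix.star_mulVec]
  have h2 := inner_self_eq_norm_sq_to_K (𝕜 := ℂ)
    (WithLp.toLp 2 (B.mulVec ψ) : EuclideanSpace ℂ ι)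
  rw [inner_eq_dotProduct] at h2
  have h3 := congrArg Complex.re h2
  rw [h3]
  exact_mod_cast (Complex.ofReal_re _).symm

lemma fidelity_proj_proj_sq (χ ψ : EuclideanSpace ℂ ι) :
    fidelity (proj χ) (proj ψ) ^ 2 = ‖(inner ℂ ψ χ : ℂ)‖ ^ 2 := by
  rw [fidelity_proj_right_sq (posSemidef_proj χ), star_dotProduct_proj_mulVec, Complex.ofReal_re]

lemma purifiedDist_proj_le_iff {ε : ℝ} (hε : 0 ≤ ε) (χ ψ : EuclideanSpace ℂ ι) :
    purifiedDist (proj χ) (proj ψ) ≤ ε ↔ 1 - ‖(inner ℂ ψ χ : ℂ)‖ ^ 2 ≤ ε ^ 2 := by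
  rw [purifiedDist, fidelity_proj_proj_sq, Real.sqrt_le_iff]
  exact and_iff_right hε

/-- A state at purified distance zero from a pure state is that pure state. -/
lemma eq_proj_of_purifiedDist_le_zero {ρ : Matrix ι ι ℂ} (hρ : IsState ρ)
    {ψ : EuclideanSpace ℂ ι} (hψ : ‖ψ‖ = 1) (h : purifiedDist ρ (proj ψ) ≤ 0) :
    ρ = proj ψ := by
  rw [purifiedDist, Real.sqrt_le_iff, fidelity_proj_right_sq hρ.1] at h
  set B := CFC.sqrt ρ with hB
  -- The columns of `√ρ` decompose `ρ` into rank-one operators.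
  let v : ι → EuclideanSpace ℂ ι := fun n => WithLp.toLp 2 fun i => B i n
  have hv : ∑ n, proj (v n) = ρ := by
    have h1 : B * B.conjTranspose = ρ := by
      rw [hB, conjTranspose_sqrt, CFC.sqrt_mul_sqrt_self ρ hρ.1.nonneg]
    rw [← h1]
    ext i j
    rw [Matrix.sum_apply, Matrix.mul_apply]
    rfl
  have hsm := eq_smul_of_trace_le v hψ hv (by rw [hρ.2, Complex.one_re]; linarith [h.2])
  obtain ⟨c, hc⟩ : ∃ c : ℂ, ρ = c • proj ψ := by
    refine ⟨∑ n, (inner ℂ ψ (v n) : ℂ) * star (inner ℂ ψ (v n) : ℂ), ?_⟩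
    rw [← hv, Finset.sum_smul]
    refine Finset.sum_congr rfl fun n _ => ?_
    conv_lhs => rw [hsm n, proj_smul]
  have htr := hρ.2
  rw [hc, Matrix.trace_smul, trace_proj, hψ] at htr
  have : c = 1 := by simpa using htr
  rw [hc, this, one_smul]

/-- Coefficient distributions of unit vectors are at most their purified distance apart. -/
lemma coeffDist_le_add {χ ψ : EuclideanSpace ℂ ι} (hχ : ‖χ‖ = 1) (hψ : ‖ψ‖ = 1) {ε : ℝ}
    (hε : 0 ≤ ε) (h : 1 - ‖(inner ℂ ψ χ : ℂ)‖ ^ 2 ≤ ε ^ 2) (i : ι) :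
    coeffDist χ i ≤ coeffDist ψ i + ε := by
  set R := Finset.univ.erase i
  have hsplit : ∀ f : ι → ℝ, ∑ j, f j = f i + ∑ j ∈ R, f j := fun f =>
    (Finset.add_sum_erase _ f (Finset.mem_univ i)).symm
  -- Lumping the other coordinates together leaves unit vectors `(x, y)` and `(a, b)` in the plane.
  -- The bound is then `sin² α - sin² β = sin (α - β) sin (α + β)`, where the overlap controls the
  -- first factor.
  set x := ‖χ i‖ with hx
  set a := ‖ψ i‖ with ha
  set y := Real.sqrt (∑ j ∈ R, ‖χ j‖ ^ 2)
  set b := Real.sqrt (∑ j ∈ R, ‖ψ j‖ ^ 2)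
  have hy : x ^ 2 + y ^ 2 = 1 := by
    rw [Real.sq_sqrt (Finset.sum_nonneg fun j _ => sq_nonneg _), ← sum_coeffDist hχ, hsplit]; rfl
  have hb : a ^ 2 + b ^ 2 = 1 := by
    rw [Real.sq_sqrt (Finset.sum_nonneg fun j _ => sq_nonneg _), ← sum_coeffDist hψ, hsplit]; rfl
  have hF : ‖(inner ℂ ψ χ : ℂ)‖ ≤ a * x + b * y := by
    rw [inner_eq_dotProduct]
    calc _ ≤ ∑ j, ‖ψ j‖ * ‖χ j‖ := by
          refine (norm_sum_le _ _).trans (le_of_eq (Finset.sum_congr rfl fun j _ => ?_))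
          simp
      _ ≤ _ := by
          rw [hsplit]
          exact add_le_add_right (Real.sum_mul_le_sqrt_mul_sqrt R _ _) _
  have hF2 : ‖(inner ℂ ψ χ : ℂ)‖ ^ 2 ≤ (a * x + b * y) ^ 2 :=
    pow_le_pow_left₀ (norm_nonneg _) hF 2
  have hid : (a * x + b * y) ^ 2 + (x * b - y * a) ^ 2 = 1 := by
    linear_combination (a ^ 2 + b ^ 2) * hy + hb
  have hid' : (x * b + y * a) ^ 2 + (x * a - y * b) ^ 2 = 1 := by
    linear_combination (a ^ 2 + b ^ 2) * hy + hb
  have hu : |x * b - y * a| ≤ ε := abs_le_of_sq_le_sq (by linarith) hε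
  have hv : |x * b + y * a| ≤ 1 :=
    abs_le_of_sq_le_sq (by nlinarith [sq_nonneg (x * a - y * b)]) zero_le_one
  have huv : x ^ 2 - a ^ 2 = (x * b - y * a) * (x * b + y * a) := by
    linear_combination a ^ 2 * hy - x ^ 2 * hb
  have : x ^ 2 - a ^ 2 ≤ ε := by
    rw [huv]
    refine (le_abs_self _).trans ?_
    rw [abs_mul]
    calc _ ≤ ε * 1 := mul_le_mul hu hv (abs_nonneg _) hε
      _ = ε := mul_one ε
  change x ^ 2 ≤ a ^ 2 + ε
  linarith

/-! ### Coefficients and overlaps of maximally coherent states -/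

lemma coeffDist_maxCoherent {d N : ℕ} (i : Fin d) :
    coeffDist (maxCoherent d N) i = if (i : ℕ) < N then 1 / (N : ℝ) else 0 := by
  simp only [coeffDist, maxCoherent]
  split_ifs with h
  · rw [Complex.norm_real, Real.norm_eq_abs, sq_abs, div_pow, Real.sq_sqrt (Nat.cast_nonneg N),
      one_pow]
  · simp

lemma norm_eq_one_of_sum_coeffDist {ι : Type} [Fintype ι] {ψ : EuclideanSpace ℂ ι} (h : ∑ i, coeffDist ψ i = 1) :
    ‖ψ‖ = 1 := by
  have h2 : ‖ψ‖ ^ 2 = 1 := by rw [EuclideanSpace.norm_sq_eq]; exact h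
  exact (pow_eq_one_iff_of_nonneg (norm_nonneg ψ) two_ne_zero).1 h2

lemma norm_maxCoherent {d N : ℕ} (h1 : 1 ≤ N) (hN : N ≤ d) : ‖maxCoherent d N‖ = 1 := by
  refine norm_eq_one_of_sum_coeffDist ?_
  simp only [coeffDist_maxCoherent]
  rw [← Finset.sum_filter, Finset.sum_const, card_fin_filter_lt hN, nsmul_eq_mul]
  have : (N : ℝ) ≠ 0 := by positivity
  field_simp

/-- The overlap with a maximally coherent state is limited by the number of non-zero
coefficients. -/
lemma norm_inner_maxCoherent_sq_le {d N : ℕ} {χ : EuclideanSpace ℂ (Fin d)} (hχ : ‖χ‖ = 1) :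
    ‖(inner ℂ (maxCoherent d N) χ : ℂ)‖ ^ 2 ≤ (coherenceRank χ : ℝ) / N := by
  classical
  set S := Finset.univ.filter fun i => χ i ≠ 0 with hS
  have hcard : coherenceRank χ = S.card := by
    rw [coherenceRank, Nat.card_eq_fintype_card, Fintype.card_subtype]
  have h1 : ‖(inner ℂ (maxCoherent d N) χ : ℂ)‖ ≤ ∑ i ∈ S, ‖maxCoherent d N i‖ * ‖χ i‖ := by
    rw [inner_eq_dotProduct, dotProduct, ← Finset.sum_subset (Finset.subset_univ S)
      (fun i _ hi => by
        have : χ i = 0 := by simpa [hS] using hi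
        simp [this])]
    refine (norm_sum_le _ _).trans (le_of_eq (Finset.sum_congr rfl fun j _ => ?_))
    simp
  calc _ ≤ (∑ i ∈ S, ‖maxCoherent d N i‖ * ‖χ i‖) ^ 2 := pow_le_pow_left₀ (norm_nonneg _) h1 2
    _ ≤ (∑ i ∈ S, coeffDist (maxCoherent d N) i) * ∑ i ∈ S, coeffDist χ i :=
        Finset.sum_mul_sq_le_sq_mul_sq _ _ _
    _ ≤ ((coherenceRank χ : ℝ) / N) * 1 := by
        refine mul_le_mul ?_ ?_ (Finset.sum_nonneg fun i _ => coeffDist_nonneg χ i) (by positivity)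
        · calc _ ≤ ∑ i ∈ S, 1 / (N : ℝ) := Finset.sum_le_sum fun i _ => by
                rw [coeffDist_maxCoherent]; split_ifs <;> first | exact le_rfl | positivity
            _ = _ := by rw [Finset.sum_const, hcard, nsmul_eq_mul, mul_one_div]
        · rw [← sum_coeffDist hχ]
          exact Finset.sum_le_sum_of_subset_of_nonneg (Finset.subset_univ _)
            fun i _ _ => coeffDist_nonneg χ i
    _ = _ := mul_one _

end PureStates

/-! ### Product vectors and catalytic majorization -/

/-- The product vector `|φ⟩ ⊗ |ω⟩`. -/
def tensorVec {α β : Type} [Fintype α] [Fintype β] (φ : EuclideanSpace ℂ α)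
    (ω : EuclideanSpace ℂ β) : EuclideanSpace ℂ (α × β) :=
  WithLp.toLp 2 fun x => φ x.1 * ω x.2

section Tensor

variable {α β : Type} [Fintype α] [Fintype β]

lemma proj_kronecker_proj (φ : EuclideanSpace ℂ α) (ω : EuclideanSpace ℂ β) :
    proj φ ⊗ₖ proj ω = proj (tensorVec φ ω) := by
  ext ⟨i, j⟩ ⟨i', j'⟩
  simp only [Matrix.kroneckerMap_apply, proj_apply, tensorVec, star_mul']
  ring

lemma coeffDist_tensorVec (φ : EuclideanSpace ℂ α) (ω : EuclideanSpace ℂ β) (x : α × β) :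
    coeffDist (tensorVec φ ω) x = coeffDist φ x.1 * coeffDist ω x.2 := by
  simp [coeffDist, tensorVec, mul_pow]

lemma norm_tensorVec {φ : EuclideanSpace ℂ α} {ω : EuclideanSpace ℂ β} (hφ : ‖φ‖ = 1)
    (hω : ‖ω‖ = 1) : ‖tensorVec φ ω‖ = 1 := by
  refine norm_eq_one_of_sum_coeffDist ?_
  simp only [coeffDist_tensorVec, Fintype.sum_prod_type]
  rw [← Finset.sum_mul_sum, sum_coeffDist hφ, sum_coeffDist hω, one_mul]

lemma traceA_proj_tensorVec {φ : EuclideanSpace ℂ α} (hφ : ‖φ‖ = 1) (ω : EuclideanSpace ℂ β) :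
    traceA (proj (tensorVec φ ω)) = proj ω := by
  have h := (isState_proj hφ).2
  ext j j'
  rw [← proj_kronecker_proj, traceA, Matrix.of_apply]
  simp only [Matrix.kroneckerMap_apply]
  rw [← Finset.sum_mul, show ∑ i, proj φ i i = 1 from h, one_mul]

lemma traceC_proj_tensorVec (φ : EuclideanSpace ℂ α) {ω : EuclideanSpace ℂ β} (hω : ‖ω‖ = 1) :
    traceC (proj (tensorVec φ ω)) = proj φ := by
  have h := (isState_proj hω).2
  ext j j'
  rw [← proj_kronecker_proj, traceC, Matrix.of_apply]
  simp only [Matrix.kroneckerMap_apply]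
  rw [← Finset.mul_sum, show ∑ i, proj ω i i = 1 from h, mul_one]

/-- If both marginals of `∑ n, |v n⟩⟨v n|` are pure, every `v n` is a multiple of the product
of the marginals. -/
lemma exists_eq_smul_tensorVec {κ : Type*} [Fintype κ] (v : κ → EuclideanSpace ℂ (α × β))
    {χ : EuclideanSpace ℂ α} {ω : EuclideanSpace ℂ β} (hχ : ‖χ‖ = 1) (hω : ‖ω‖ = 1)
    (hA : traceA (∑ n, proj (v n)) = proj ω) (hC : traceC (∑ n, proj (v n)) = proj χ) (n : κ) :
    ∃ b : ℂ, v n = b • tensorVec χ ω := by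
  -- The slices `v n (i, ·)` decompose the pure catalyst marginal, so each is a multiple of `ω`;
  -- likewise the slices `v n (·, j)` are multiples of `χ`.
  have h1 := eq_smul_of_sum_proj
    (fun x : κ × α => (WithLp.toLp 2 fun j => v x.1 (x.2, j) : EuclideanSpace ℂ β)) hω (by
      rw [← hA]
      ext j j'
      simp only [traceA, Matrix.of_apply, Matrix.sum_apply, Fintype.sum_prod_type]
      exact Finset.sum_comm)
  have h2 := eq_smul_of_sum_proj
    (fun x : κ × β => (WithLp.toLp 2 fun i => v x.1 (i, x.2) : EuclideanSpace ℂ α)) hχ (by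
      rw [← hC]
      ext j j'
      simp only [traceC, Matrix.of_apply, Matrix.sum_apply, Fintype.sum_prod_type]
      exact Finset.sum_comm)
  let c : β → ℂ := fun j =>
    inner ℂ χ (WithLp.toLp 2 fun i => v n (i, j) : EuclideanSpace ℂ α)
  have h3 : ∀ i j, v n (i, j) = c j * χ i := fun i j =>
    congrArg (fun w : EuclideanSpace ℂ α => w i) (h2 (n, j))
  refine ⟨∑ j, star (ω j) * c j, ?_⟩
  ext ⟨i, j⟩
  have h4 := congrArg (fun w : EuclideanSpace ℂ β => w j) (h1 (n, i))
  simp only [PiLp.smul_apply, smul_eq_mul] at h4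
  rw [h4, inner_eq_dotProduct]
  simp only [dotProduct, h3, PiLp.smul_apply, smul_eq_mul, tensorVec, Finset.sum_mul,
    Pi.star_apply]
  exact Finset.sum_congr rfl fun _ _ => by ring

/-- Catalytic majorization does not decrease the largest weight. -/
lemma IsMajorizedBy.exists_le_of_tensorVec {φ χ : EuclideanSpace ℂ α} {ω : EuclideanSpace ℂ β}
    (h : IsMajorizedBy (coeffDist (tensorVec φ ω)) (coeffDist (tensorVec χ ω))) (hω : ‖ω‖ = 1)
    (i : α) : ∃ i', coeffDist φ i ≤ coeffDist χ i' := by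
  classical
  have hne : (Finset.univ : Finset β).Nonempty := by
    rw [Finset.univ_nonempty_iff]
    by_contra hcon
    rw [not_nonempty_iff] at hcon
    have := sum_coeffDist hω
    simp at this
  obtain ⟨j, -, hj⟩ := Finset.exists_max_image Finset.univ (coeffDist ω) hne
  have hjpos : 0 < coeffDist ω j := by
    refine (coeffDist_nonneg ω j).lt_of_ne' fun h0 => ?_
    have h1 := sum_coeffDist hω
    have h2 : ∑ i, coeffDist ω i ≤ 0 := Finset.sum_nonpos fun b hb => h0 ▸ hj b hb
    linarith
  -- With `j` the heaviest index of `ω`, a one-point test set suffices: the weight of `ω` at `j`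
  -- bounds the one on the right and cancels.
  obtain ⟨T, hT, hle⟩ := h {(i, j)}
  rw [Finset.sum_singleton, coeffDist_tensorVec] at hle
  have : Nonempty (α × β) := ⟨(i, j)⟩
  rw [Finset.card_singleton] at hT
  rcases Finset.card_le_one_iff_subset_singleton.1 hT with ⟨⟨i', j'⟩, hsub⟩
  refine ⟨i', ?_⟩
  have h1 : ∑ x ∈ T, coeffDist (tensorVec χ ω) x ≤ coeffDist χ i' * coeffDist ω j' := by
    refine (Finset.sum_le_sum_of_subset_of_nonneg hsub
      fun x _ _ => coeffDist_nonneg _ x).trans ?_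
    rw [Finset.sum_singleton, coeffDist_tensorVec]
  have h2 : coeffDist χ i' * coeffDist ω j' ≤ coeffDist χ i' * coeffDist ω j :=
    mul_le_mul_of_nonneg_left (hj j' (Finset.mem_univ _)) (coeffDist_nonneg _ _)
  exact le_of_mul_le_mul_right (by linarith) hjpos

/-- Majorization of unit vectors does not increase the number of non-zero coefficients. -/
lemma IsMajorizedBy.card_support_le {ι : Type} [Fintype ι] [DecidableEq ι]
    {φ χ : EuclideanSpace ℂ ι} (h : IsMajorizedBy (coeffDist φ) (coeffDist χ)) (hφ : ‖φ‖ = 1)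
    (hχ : ‖χ‖ = 1) :
    (Finset.univ.filter fun i => χ i ≠ 0).card ≤ (Finset.univ.filter fun i => φ i ≠ 0).card := by
  -- The support of `φ` has mass one, hence so does `T`, which must therefore contain the support of
  -- `χ`.
  obtain ⟨T, hT, hle⟩ := h (Finset.univ.filter fun i => φ i ≠ 0)
  refine (Finset.card_le_card fun i hi => ?_).trans hT
  rw [Finset.sum_subset (Finset.subset_univ _)
    (fun i _ hi => by
      have : φ i = 0 := by simpa using hi
      simp [coeffDist, this]), sum_coeffDist hφ, ← sum_coeffDist hχ,
      ← Finset.sum_add_sum_compl T] at hle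
  by_contra hiT
  have h0 : 0 < coeffDist χ i := pow_pos (norm_pos_iff.2 (by simpa using hi)) 2
  have h1 : coeffDist χ i ≤ ∑ i ∈ Tᶜ, coeffDist χ i :=
    Finset.single_le_sum (fun i _ => coeffDist_nonneg χ i) (by simpa using hiT)
  linarith

end Tensor

/-- Catalytic majorization does not increase the coherence rank. -/
lemma IsMajorizedBy.coherenceRank_le_of_tensorVec {d m : ℕ} {φ χ : EuclideanSpace ℂ (Fin d)}
    {ω : EuclideanSpace ℂ (Fin m)}
    (h : IsMajorizedBy (coeffDist (tensorVec φ ω)) (coeffDist (tensorVec χ ω))) (hφ : ‖φ‖ = 1)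
    (hχ : ‖χ‖ = 1) (hω : ‖ω‖ = 1) : coherenceRank χ ≤ coherenceRank φ := by
  classical
  have hcard : ∀ ψ : EuclideanSpace ℂ (Fin d),
      (Finset.univ.filter fun x => tensorVec ψ ω x ≠ 0).card =
        coherenceRank ψ * coherenceRank ω := by
    intro ψ
    rw [coherenceRank, coherenceRank, Nat.card_eq_fintype_card, Nat.card_eq_fintype_card,
      Fintype.card_subtype, Fintype.card_subtype, ← Finset.card_product]
    congr 1
    ext ⟨i, j⟩
    simp [tensorVec]
  have h1 := h.card_support_le (norm_tensorVec hφ hω) (norm_tensorVec hχ hω)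
  rw [hcard, hcard] at h1
  refine Nat.le_of_mul_le_mul_right h1 (Nat.pos_of_ne_zero fun h0 => ?_)
  rw [coherenceRank, Nat.card_eq_fintype_card, Fintype.card_eq_zero_iff] at h0
  have : ω = 0 := by
    ext j
    by_contra hj
    exact h0.false ⟨j, hj⟩
  rw [this, norm_zero] at hω
  exact zero_ne_one hω

/-! ### Feasible sets in terms of majorization -/

section Distillation

variable {d : ℕ} {φ : EuclideanSpace ℂ (Fin d)} {O : OpClass} {ε : ℝ} {N : ℕ}

/-- The right-hand side does not mention `O`; this is the equality of IO and SIO. -/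
lemma mem_pureDistillSet_iff (hφ : ‖φ‖ = 1) :
    N ∈ pureDistillSet O ε φ ↔ 1 ≤ N ∧ N ≤ d ∧ ∃ χ : EuclideanSpace ℂ (Fin d), ‖χ‖ = 1 ∧
      IsMajorizedBy (coeffDist φ) (coeffDist χ) ∧
      purifiedDist (proj χ) (proj (maxCoherent d N)) ≤ ε := by
  refine and_congr_right fun _ => and_congr_right fun _ => ⟨?_, ?_⟩
  · rintro ⟨Λ, χ, hΛ, hχ, hout, hP⟩
    obtain ⟨k, K, ⟨hK, hKΛ⟩, hI⟩ := hΛ.incoherent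
    refine ⟨χ, hχ, ?_, hP⟩
    rw [hKΛ] at hout
    simp only [mul_proj_mul_conjTranspose] at hout
    have := eq_smul_of_sum_proj _ hχ hout
    exact isMajorizedBy_of_kraus hK hI hφ hχ _
      fun n => congrArg WithLp.ofLp (this n)
  · rintro ⟨χ, hχ, hmaj, hP⟩
    obtain ⟨Λ, hΛ, hout⟩ := hmaj.exists_strictlyIncoherent hφ hχ
    exact ⟨Λ, χ, OpClass.Mem.of_strictlyIncoherent O hΛ, hχ, hout, hP⟩

lemma mem_pureDistillPcSet_iff (hφ : ‖φ‖ = 1) :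
    N ∈ pureDistillPcSet O ε φ ↔ 1 ≤ N ∧ N ≤ d ∧ ∃ (m : ℕ) (ω : EuclideanSpace ℂ (Fin m))
      (χ : EuclideanSpace ℂ (Fin d)), ‖ω‖ = 1 ∧ ‖χ‖ = 1 ∧
      IsMajorizedBy (coeffDist (tensorVec φ ω)) (coeffDist (tensorVec χ ω)) ∧
      purifiedDist (proj χ) (proj (maxCoherent d N)) ≤ ε := by
  refine and_congr_right fun _ => and_congr_right fun _ => ⟨?_, ?_⟩
  · rintro ⟨m, Λ, ω, χ, hΛ, hω, hχ, hA, hC, hP⟩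
    obtain ⟨k, K, ⟨hK, hKΛ⟩, hI⟩ := hΛ.incoherent
    refine ⟨m, ω, χ, hω, hχ, ?_, hP⟩
    rw [proj_kronecker_proj, hKΛ] at hA hC
    simp only [mul_proj_mul_conjTranspose] at hA hC
    choose b hb using exists_eq_smul_tensorVec _ hχ hω hA hC
    exact isMajorizedBy_of_kraus hK hI (norm_tensorVec hφ hω) (norm_tensorVec hχ hω) b
      fun n => congrArg WithLp.ofLp (hb n)
  · rintro ⟨m, ω, χ, hω, hχ, hmaj, hP⟩
    obtain ⟨Λ, hΛ, hout⟩ :=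
      hmaj.exists_strictlyIncoherent (norm_tensorVec hφ hω) (norm_tensorVec hχ hω)
    refine ⟨m, Λ, ω, χ, OpClass.Mem.of_strictlyIncoherent O hΛ, hω, hχ, ?_, ?_, hP⟩
    · rw [proj_kronecker_proj, hout, traceA_proj_tensorVec hχ]
    · rw [proj_kronecker_proj, hout, traceC_proj_tensorVec _ hω]

lemma pureDistillSet_subset_pureDistillPcSet (hφ : ‖φ‖ = 1) :
    pureDistillSet O ε φ ⊆ pureDistillPcSet O ε φ := by
  intro N hN
  rw [mem_pureDistillSet_iff hφ] at hN
  rw [mem_pureDistillPcSet_iff hφ]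
  obtain ⟨h1, h2, χ, hχ, hmaj, hP⟩ := hN
  -- The trivial one-dimensional catalyst.
  have hω : ‖(WithLp.toLp 2 fun _ => 1 : EuclideanSpace ℂ (Fin 1))‖ = 1 :=
    norm_eq_one_of_sum_coeffDist (by simp [coeffDist])
  refine ⟨h1, h2, 1, _, χ, hω, hχ, fun S => ?_, hP⟩
  obtain ⟨T, hT, hle⟩ := hmaj (S.map (Equiv.prodUnique (Fin d) (Fin 1)).toEmbedding)
  refine ⟨T.map (Equiv.prodUnique (Fin d) (Fin 1)).symm.toEmbedding, by simpa using hT, ?_⟩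
  simp only [coeffDist_tensorVec]
  rw [Finset.sum_map] at hle ⊢
  simpa [coeffDist] using hle

/-- If all weights of `φ` are at most `1 / N + ε`, then `φ` is majorized by a unit vector whose
overlap with the maximally coherent state of rank `N` is close to one. -/
lemma exists_majorizing_near_maxCoherent (hφ : ‖φ‖ = 1) (h1 : 1 ≤ N) (hN : N ≤ d)
    (hε : 0 ≤ ε) (hNε : (N : ℝ) * ((N : ℝ) - 1) * ε ≤ 1)
    (hp : ∀ i, coeffDist φ i ≤ 1 / N + ε) :
    ∃ χ : EuclideanSpace ℂ (Fin d), ‖χ‖ = 1 ∧ IsMajorizedBy (coeffDist φ) (coeffDist χ) ∧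
      1 - ‖(inner ℂ (maxCoherent d N) χ : ℂ)‖ ^ 2 ≤ 2 * ((N : ℝ) - 1) * ε := by
  obtain ⟨M, rfl⟩ : ∃ M, N = M + 1 := ⟨N - 1, by omega⟩
  set t : ℝ := 1 / ((M + 1 : ℕ) : ℝ) with ht
  have ht0 : 0 < t := by positivity
  have htN : ((M : ℝ) + 1) * t = 1 := by rw [ht]; push_cast; field_simp
  have hMε : (M : ℝ) * ε ≤ t := by
    have : ((M : ℝ) + 1) * (M * ε) ≤ ((M : ℝ) + 1) * t := by
      rw [htN]; push_cast at hNε; linarith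
    exact le_of_mul_le_mul_left this (by positivity)
  have htle : t ≤ 1 := by nlinarith [(Nat.cast_nonneg M : (0 : ℝ) ≤ M)]
  -- The first `N - 1` weights are raised to the allowed maximum `1/N + ε` and the last one pays for
  -- it; the hypothesis on `N(N-1)ε` keeps it nonnegative.
  let q : ℕ → ℝ := fun i => if i < M then t + ε else if i = M then t - M * ε else 0
  have hq0 : ∀ i, 0 ≤ q i := by
    intro i
    simp only [q]
    split_ifs <;> linarith
  let χ : EuclideanSpace ℂ (Fin d) := WithLp.toLp 2 fun i => (Real.sqrt (q i) : ℂ)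
  have hcd : ∀ i, coeffDist χ i = q i := fun i => by
    simp only [coeffDist, χ]
    rw [Complex.norm_real, Real.norm_eq_abs, sq_abs, Real.sq_sqrt (hq0 _)]
  have hsumlt : ∀ k ≤ M, ∑ i ∈ Finset.range k, q i = k * (t + ε) := by
    intro k hk
    rw [Finset.sum_congr rfl (g := fun _ => t + ε) fun i hi => by
      have : i < M := lt_of_lt_of_le (Finset.mem_range.1 hi) hk
      simp [q, this]]
    rw [Finset.sum_const, Finset.card_range, nsmul_eq_mul]
  have hsumN : ∑ i ∈ Finset.range (M + 1), q i = 1 := by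
    rw [Finset.sum_range_succ, hsumlt M le_rfl]
    simp only [q, lt_irrefl, if_false, if_true]
    linarith
  have hsum : ∑ i, coeffDist χ i = 1 := by
    simp only [hcd]
    rw [Fin.sum_univ_eq_sum_range q, ← hsumN]
    symm
    refine Finset.sum_subset (Finset.range_mono hN) fun i _ hi => ?_
    rw [Finset.mem_range] at hi
    simp [q, show ¬ i < M by omega, show i ≠ M by omega]
  refine ⟨χ, norm_eq_one_of_sum_coeffDist hsum, fun S => ?_, ?_⟩
  · by_cases hS : M + 1 ≤ S.card
    · refine ⟨Finset.univ.filter fun i => (i : ℕ) < M + 1, by rwa [card_fin_filter_lt hN], ?_⟩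
      simp only [hcd]
      rw [sum_fin_filter_lt hN, hsumN, ← sum_coeffDist hφ]
      exact Finset.sum_le_sum_of_subset_of_nonneg (Finset.subset_univ _)
        fun i _ _ => coeffDist_nonneg φ i
    · have hSd : S.card ≤ d := by omega
      refine ⟨Finset.univ.filter fun i => (i : ℕ) < S.card, by rw [card_fin_filter_lt hSd], ?_⟩
      simp only [hcd]
      rw [sum_fin_filter_lt hSd, hsumlt _ (by omega), ← nsmul_eq_mul]
      exact Finset.sum_le_card_nsmul _ _ _ fun i _ => hp i
  · have hinner : (inner ℂ (maxCoherent d (M + 1)) χ : ℂ) =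
        ((∑ i ∈ Finset.range (M + 1), Real.sqrt t * Real.sqrt (q i) : ℝ) : ℂ) := by
      rw [← sum_fin_filter_lt hN (fun i => Real.sqrt t * Real.sqrt (q i)), Finset.sum_filter,
        inner_eq_dotProduct, dotProduct, Complex.ofReal_sum]
      refine Finset.sum_congr rfl fun i _ => ?_
      simp only [maxCoherent, χ, Pi.star_apply]
      split_ifs with hi
      · rw [ht, Real.sqrt_div zero_le_one, Real.sqrt_one, Complex.star_def, Complex.conj_ofReal,
          Complex.ofReal_mul]
      · simp
    -- The overlap is at least the sum of the minima, which is `1 - Mε`.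
    have hmin : ∀ i, min t (q i) ≤ Real.sqrt t * Real.sqrt (q i) := by
      intro i
      have hm : 0 ≤ min t (q i) := le_min ht0.le (hq0 i)
      calc min t (q i) = Real.sqrt (min t (q i)) * Real.sqrt (min t (q i)) :=
            (Real.mul_self_sqrt hm).symm
        _ ≤ _ := mul_le_mul (Real.sqrt_le_sqrt (min_le_left _ _))
            (Real.sqrt_le_sqrt (min_le_right _ _)) (Real.sqrt_nonneg _) (Real.sqrt_nonneg _)
    have hF : 1 - M * ε ≤ ∑ i ∈ Finset.range (M + 1), Real.sqrt t * Real.sqrt (q i) := by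
      refine le_trans (le_of_eq ?_) (Finset.sum_le_sum fun i _ => hmin i)
      rw [Finset.sum_range_succ, Finset.sum_congr rfl (g := fun _ => t) fun i hi => by
        rw [Finset.mem_range] at hi
        simp [q, hi, hε]]
      have hMε0 : 0 ≤ (M : ℝ) * ε := by positivity
      simp only [q, lt_irrefl, if_false, if_true, Finset.sum_const, Finset.card_range,
        nsmul_eq_mul]
      rw [min_eq_right (by linarith)]
      linarith
    rw [hinner, Complex.norm_real, Real.norm_eq_abs, sq_abs]
    have := pow_le_pow_left₀ (show 0 ≤ 1 - M * ε by linarith) hF 2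
    push_cast
    nlinarith [sq_nonneg ((M : ℝ) * ε)]

lemma coeffDist_le_of_mem_pureDistillPcSet (hφ : ‖φ‖ = 1) (hε : 0 ≤ ε)
    (h : N ∈ pureDistillPcSet O ε φ) (i : Fin d) : coeffDist φ i ≤ 1 / N + ε := by
  obtain ⟨h1, h2, m, ω, χ, hω, hχ, hmaj, hP⟩ := (mem_pureDistillPcSet_iff hφ).1 h
  obtain ⟨i', hi'⟩ := hmaj.exists_le_of_tensorVec hω i
  rw [purifiedDist_proj_le_iff hε] at hP
  have h3 := coeffDist_le_add hχ (norm_maxCoherent h1 h2) hε hP i'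
  have h4 : coeffDist (maxCoherent d N) i' ≤ 1 / N := by
    rw [coeffDist_maxCoherent]
    split_ifs
    · exact le_rfl
    · positivity
  linarith

/-- A vector of rank at most `r` has squared overlap at most `r/(r+1)` with `Ψ_N` for `N > r`, so
`ε² ≥ 1/(r+1)`. With `r(r-1)ε ≤ 1` this gives `r² ≤ (r(r-1))² ≤ r + 1`, impossible for `r ≥ 2`. -/
lemma le_coherenceRank_of_mem_pureDistillPcSet (hφ : ‖φ‖ = 1) (hε : 0 ≤ ε)
    (hr : 1 < coherenceRank φ)
    (hrε : (coherenceRank φ : ℝ) * ((coherenceRank φ : ℝ) - 1) * ε ≤ 1)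
    (h : N ∈ pureDistillPcSet O ε φ) : N ≤ coherenceRank φ := by
  obtain ⟨h1, h2, m, ω, χ, hω, hχ, hmaj, hP⟩ := (mem_pureDistillPcSet_iff hφ).1 h
  by_contra hcon
  push Not at hcon
  set r := coherenceRank φ
  have hrank : coherenceRank χ ≤ r := hmaj.coherenceRank_le_of_tensorVec hφ hχ hω
  rw [purifiedDist_proj_le_iff hε] at hP
  have hF := norm_inner_maxCoherent_sq_le (N := N) hχ
  have hr2 : (2 : ℝ) ≤ r := by exact_mod_cast hr
  have hq : (coherenceRank χ : ℝ) / N ≤ r / (r + 1) :=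
    div_le_div₀ (by positivity) (by exact_mod_cast hrank) (by positivity) (by exact_mod_cast hcon)
  have hlow : 1 / ((r : ℝ) + 1) ≤ ε ^ 2 := by
    have : 1 / ((r : ℝ) + 1) = 1 - r / (r + 1) := by field_simp; ring
    linarith
  set s := (r : ℝ) * ((r : ℝ) - 1)
  have hs : (r : ℝ) ≤ s := by nlinarith
  have h5 : (s * ε) ^ 2 ≤ 1 := pow_le_one₀ (mul_nonneg (by linarith) hε) hrε
  rw [div_le_iff₀ (by positivity)] at hlow
  have h6 : s ^ 2 ≤ r + 1 := by nlinarith [sq_nonneg s]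
  nlinarith

lemma mem_pureDistillSet_sqrt_of_mem_pureDistillPcSet (hφ : ‖φ‖ = 1) (hε : 0 ≤ ε)
    (hr : 1 < coherenceRank φ)
    (hrε : (coherenceRank φ : ℝ) * ((coherenceRank φ : ℝ) - 1) * ε ≤ 1)
    (h : N ∈ pureDistillPcSet O ε φ) :
    N ∈ pureDistillSet O
      (Real.sqrt ((coherenceRank φ : ℝ) * ((coherenceRank φ : ℝ) - 1) * ε)) φ := by
  have h1 := h.1
  have h2 := h.2.1
  have hNr : (N : ℝ) ≤ coherenceRank φ := by
    exact_mod_cast le_coherenceRank_of_mem_pureDistillPcSet hφ hε hr hrε h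
  have hN1 : (1 : ℝ) ≤ N := by exact_mod_cast h1
  have hr2 : (2 : ℝ) ≤ coherenceRank φ := by exact_mod_cast hr
  set r : ℝ := (coherenceRank φ : ℝ)
  have hle : (N : ℝ) * ((N : ℝ) - 1) ≤ r * (r - 1) :=
    mul_le_mul hNr (by linarith) (by linarith) (by linarith)
  -- Turns the error `2(N-1)ε` into `r(r-1)ε`, using `r ≥ 2`.
  have hle2 : 2 * ((N : ℝ) - 1) ≤ r * (r - 1) :=
    mul_le_mul hr2 (by linarith) (by linarith) (by linarith)
  obtain ⟨χ, hχ, hmaj, hF⟩ := exists_majorizing_near_maxCoherent hφ h1 h2 hε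
    ((mul_le_mul_of_nonneg_right hle hε).trans hrε) (coeffDist_le_of_mem_pureDistillPcSet hφ hε h)
  refine (mem_pureDistillSet_iff hφ).2 ⟨h1, h2, χ, hχ, hmaj, ?_⟩
  rw [purifiedDist_proj_le_iff (Real.sqrt_nonneg _), Real.sq_sqrt (mul_nonneg (by nlinarith) hε)]
  exact hF.trans (mul_le_mul_of_nonneg_right hle2 hε)

lemma mem_pureDistillSet_of_coeffDist_le (hφ : ‖φ‖ = 1) (hε : 0 ≤ ε) (h1 : 1 ≤ N) (h2 : N ≤ d)
    (h : ∀ i, coeffDist φ i ≤ 1 / N) : N ∈ pureDistillSet O ε φ := by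
  obtain ⟨χ, hχ, hmaj, hF⟩ := exists_majorizing_near_maxCoherent hφ h1 h2 le_rfl
    (by simp) (by simpa using h)
  refine (mem_pureDistillSet_iff hφ).2 ⟨h1, h2, χ, hχ, hmaj, ?_⟩
  rw [purifiedDist_proj_le_iff hε]
  nlinarith [sq_nonneg ε]

/-! ### Exact distillation -/

lemma isState_apply_proj {ι : Type} [Fintype ι] [DecidableEq ι] {O : OpClass}
    {Λ : Matrix ι ι ℂ → Matrix ι ι ℂ} (hΛ : O.Mem Λ) {ψ : EuclideanSpace ℂ ι} (hψ : ‖ψ‖ = 1) :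
    IsState (Λ (proj ψ)) := by
  obtain ⟨k, K, ⟨hK, hKΛ⟩, -⟩ := hΛ.incoherent
  rw [hKΛ]
  refine ⟨Matrix.posSemidef_sum _ fun n _ => (posSemidef_proj ψ).mul_mul_conjTranspose_same _, ?_⟩
  rw [Matrix.trace_sum]
  simp only [Matrix.trace_mul_comm _ (Matrix.conjTranspose _), ← mul_assoc]
  rw [← Matrix.trace_sum, ← Finset.sum_mul, hK, one_mul, (isState_proj hψ).2]

lemma distillSet_zero_eq (hφ : ‖φ‖ = 1) :
    distillSet O 0 (proj φ) = pureDistillSet O 0 φ := by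
  ext N
  refine and_congr_right fun h1 => and_congr_right fun h2 => ⟨?_, ?_⟩
  · rintro ⟨Λ, hΛ, hP⟩
    have hout := eq_proj_of_purifiedDist_le_zero (isState_apply_proj hΛ hφ)
      (norm_maxCoherent h1 h2) hP
    exact ⟨Λ, _, hΛ, norm_maxCoherent h1 h2, hout, hout ▸ hP⟩
  · rintro ⟨Λ, χ, hΛ, -, hout, hP⟩
    exact ⟨Λ, hΛ, hout ▸ hP⟩

lemma distillPcSet_zero_eq : distillPcSet O 0 (proj φ) = pureDistillPcSet O 0 φ := by
  ext N
  refine and_congr_right fun h1 => and_congr_right fun h2 => ⟨?_, ?_⟩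
  · rintro ⟨m, Λ, ω, ρ, hΛ, hω, hρ, hA, hC, hP⟩
    have hout := eq_proj_of_purifiedDist_le_zero hρ (norm_maxCoherent h1 h2) hP
    subst hout
    exact ⟨m, Λ, ω, _, hΛ, hω, norm_maxCoherent h1 h2, hA, hC, hP⟩
  · rintro ⟨m, Λ, ω, χ, hΛ, hω, hχ, hA, hC, hP⟩
    exact ⟨m, Λ, ω, _, hΛ, hω, isState_proj hχ, hA, hC, hP⟩

lemma coeffDist_le_one (hφ : ‖φ‖ = 1) (i : Fin d) : coeffDist φ i ≤ 1 := by
  rw [← sum_coeffDist hφ]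
  exact Finset.single_le_sum (fun i _ => coeffDist_nonneg φ i) (Finset.mem_univ i)

lemma pos_of_norm_eq_one (hφ : ‖φ‖ = 1) : 0 < d := by
  rcases Nat.eq_zero_or_pos d with h | h
  · subst h
    have := sum_coeffDist hφ
    simp at this
  · exact h

lemma one_mem_pureDistillSet (hφ : ‖φ‖ = 1) (hε : 0 ≤ ε) : 1 ∈ pureDistillSet O ε φ :=
  mem_pureDistillSet_of_coeffDist_le hφ hε le_rfl (pos_of_norm_eq_one hφ)
    (by simpa using coeffDist_le_one hφ)

lemma coeffDist_le_maxCoeff (φ : EuclideanSpace ℂ (Fin d)) (i : Fin d) :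
    coeffDist φ i ≤ maxCoeff φ :=
  le_ciSup (f := fun i => ‖φ i‖ ^ 2) (Set.finite_range _).bddAbove i

lemma one_le_mul_maxCoeff (hφ : ‖φ‖ = 1) : 1 ≤ d * maxCoeff φ := by
  rw [← sum_coeffDist hφ]
  refine (Finset.sum_le_card_nsmul _ _ _ fun i _ => coeffDist_le_maxCoeff φ i).trans ?_
  simp

lemma maxCoeff_pos (hφ : ‖φ‖ = 1) : 0 < maxCoeff φ :=
  pos_of_mul_pos_right (zero_lt_one.trans_le (one_le_mul_maxCoeff hφ)) (Nat.cast_nonneg d)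

lemma le_floor_inv_maxCoeff_iff (hφ : ‖φ‖ = 1) (h1 : 1 ≤ N) :
    N ≤ ⌊1 / maxCoeff φ⌋₊ ↔ ∀ i, coeffDist φ i ≤ 1 / N := by
  have hpos := maxCoeff_pos hφ
  have hN : (0 : ℝ) < N := by exact_mod_cast h1
  have : Nonempty (Fin d) := ⟨⟨0, pos_of_norm_eq_one hφ⟩⟩
  rw [Nat.le_floor_iff (by positivity), le_div_comm₀ hN hpos]
  exact ciSup_le_iff (Set.finite_range _).bddAbove

lemma floor_inv_maxCoeff_le (hφ : ‖φ‖ = 1) : ⌊1 / maxCoeff φ⌋₊ ≤ d := by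
  refine Nat.floor_le_of_le ?_
  have := one_le_mul_maxCoeff hφ
  rwa [div_le_iff₀ (maxCoeff_pos hφ)]

lemma pureDistillSet_zero_eq (hφ : ‖φ‖ = 1) :
    pureDistillSet O 0 φ = Set.Icc 1 ⌊1 / maxCoeff φ⌋₊ := by
  ext N
  constructor
  · intro h
    refine ⟨h.1, (le_floor_inv_maxCoeff_iff hφ h.1).2 fun i => ?_⟩
    simpa using coeffDist_le_of_mem_pureDistillPcSet hφ le_rfl
      (pureDistillSet_subset_pureDistillPcSet hφ h) i
  · rintro ⟨h1, h2⟩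
    exact mem_pureDistillSet_of_coeffDist_le hφ le_rfl h1 (h2.trans (floor_inv_maxCoeff_le hφ))
      ((le_floor_inv_maxCoeff_iff hφ h1).1 h2)

/-- The catalytic necessary condition at `ε = 0` already suffices without a catalyst. -/
lemma pureDistillPcSet_zero_eq (hφ : ‖φ‖ = 1) :
    pureDistillPcSet O 0 φ = Set.Icc 1 ⌊1 / maxCoeff φ⌋₊ := by
  refine Set.Subset.antisymm (fun N h => ?_) ?_
  · refine ⟨h.1, (le_floor_inv_maxCoeff_iff hφ h.1).2 fun i => ?_⟩
    simpa using coeffDist_le_of_mem_pureDistillPcSet hφ le_rfl h i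
  · rw [← pureDistillSet_zero_eq (O := O) hφ]
    exact pureDistillSet_subset_pureDistillPcSet hφ

end Distillation

/-! ### Attained maxima and the theorem -/

lemma finite_logSet {S : Set ℕ} {d : ℕ} (hS : ∀ N ∈ S, N ≤ d) : (logSet S).Finite :=
  ((Set.finite_Iic d).subset hS).image _

lemma isGreatest_sSup_logSet {S : Set ℕ} {d : ℕ} (hS : ∀ N ∈ S, N ≤ d) (h : S.Nonempty) :
    IsGreatest (logSet S) (sSup (logSet S)) :=
  ⟨(h.image _).csSup_mem (finite_logSet hS),
    fun _ hx => le_csSup (finite_logSet hS).bddAbove hx⟩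

lemma sSup_logSet_mono {S T : Set ℕ} {d : ℕ} (hT : ∀ N ∈ T, N ≤ d) (h : S.Nonempty)
    (hST : S ⊆ T) : sSup (logSet S) ≤ sSup (logSet T) :=
  csSup_le_csSup (finite_logSet hT).bddAbove (h.image _) (Set.image_mono hST)

lemma sSup_logSet_Icc {M : ℕ} (hM : 1 ≤ M) :
    sSup (logSet (Set.Icc 1 M)) = Real.logb 2 M := by
  refine IsGreatest.csSup_eq ⟨⟨M, ⟨hM, le_rfl⟩, rfl⟩, ?_⟩
  rintro _ ⟨N, ⟨h1, h2⟩, rfl⟩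
  exact Real.logb_le_logb_of_le one_lt_two (by exact_mod_cast h1) (by exact_mod_cast h2)

end Coherence

end

open Coherence in
theorem theorem3 {d : ℕ} (φ : EuclideanSpace ℂ (Fin d)) (hφ : ‖φ‖ = 1)
    (r : ℕ) (hr : r = coherenceRank φ) (hr1 : 1 < r) :
    -- the suprema in the definitions are attained maxima
    (∀ (O : OpClass) (ε : ℝ), 0 ≤ ε →
      IsGreatest (logSet (pureDistillSet O ε φ)) (Ctilde_d O ε φ) ∧
      IsGreatest (logSet (pureDistillPcSet O ε φ)) (Ctilde_pc O ε φ)) ∧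
    (∀ O : OpClass,
      IsGreatest (logSet (distillSet O 0 (proj φ))) (C_d O 0 (proj φ)) ∧
      IsGreatest (logSet (distillPcSet O 0 (proj φ))) (C_pc O 0 (proj φ))) ∧
    -- smoothed distillation
    (∀ ε : ℝ, 0 ≤ ε → (r : ℝ) * ((r : ℝ) - 1) * ε ≤ 1 →
      (Ctilde_d .incoherent ε φ ≤ Ctilde_pc .incoherent ε φ ∧
        Ctilde_pc .incoherent ε φ ≤ Ctilde_d .incoherent (Real.sqrt ((r : ℝ) * ((r : ℝ) - 1) * ε)) φ) ∧
      Ctilde_d .incoherent ε φ = Ctilde_d .strictlyIncoherent ε φ ∧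
      Ctilde_pc .incoherent ε φ = Ctilde_pc .strictlyIncoherent ε φ) ∧
    -- exact distillation, with arbitrary and with pure output states
    (∀ O : OpClass,
      C_d O 0 (proj φ) = Real.logb 2 ⌊1 / maxCoeff φ⌋₊ ∧
      C_pc O 0 (proj φ) = Real.logb 2 ⌊1 / maxCoeff φ⌋₊ ∧
      Ctilde_d O 0 φ = Real.logb 2 ⌊1 / maxCoeff φ⌋₊ ∧
      Ctilde_pc O 0 φ = Real.logb 2 ⌊1 / maxCoeff φ⌋₊) := by
  have hd : ∀ (O : OpClass) (ε : ℝ), ∀ N ∈ pureDistillSet O ε φ, N ≤ d := fun O ε N h => h.2.1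
  have hpc : ∀ (O : OpClass) (ε : ℝ), ∀ N ∈ pureDistillPcSet O ε φ, N ≤ d :=
    fun O ε N h => h.2.1
  have hdne : ∀ (O : OpClass) (ε : ℝ), 0 ≤ ε → (pureDistillSet O ε φ).Nonempty :=
    fun O ε hε => ⟨1, one_mem_pureDistillSet hφ hε⟩
  have hpcne : ∀ (O : OpClass) (ε : ℝ), 0 ≤ ε → (pureDistillPcSet O ε φ).Nonempty :=
    fun O ε hε => (hdne O ε hε).mono (pureDistillSet_subset_pureDistillPcSet hφ)
  have hmax : ∀ (O : OpClass) (ε : ℝ), 0 ≤ ε →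
      IsGreatest (logSet (pureDistillSet O ε φ)) (Ctilde_d O ε φ) ∧
      IsGreatest (logSet (pureDistillPcSet O ε φ)) (Ctilde_pc O ε φ) := fun O ε hε =>
    ⟨isGreatest_sSup_logSet (hd O ε) (hdne O ε hε),
      isGreatest_sSup_logSet (hpc O ε) (hpcne O ε hε)⟩
  have hfloor : 1 ≤ ⌊1 / maxCoeff φ⌋₊ :=
    (le_floor_inv_maxCoeff_iff hφ le_rfl).2 (by simpa using coeffDist_le_one hφ)
  refine ⟨hmax, fun O => ?_, fun ε hε hrε => ⟨⟨?_, ?_⟩, ?_, ?_⟩, fun O => ?_⟩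
  · rw [C_d, C_pc, distillSet_zero_eq hφ, distillPcSet_zero_eq]
    exact hmax O 0 le_rfl
  · exact sSup_logSet_mono (hpc _ _) (hdne _ _ hε) (pureDistillSet_subset_pureDistillPcSet hφ)
  · subst hr
    exact sSup_logSet_mono (hd _ _) (hpcne _ _ hε) fun N h =>
      mem_pureDistillSet_sqrt_of_mem_pureDistillPcSet hφ hε hr1 hrε h
  · rw [Ctilde_d, Ctilde_d]
    congr 2
    ext N
    rw [mem_pureDistillSet_iff hφ, mem_pureDistillSet_iff hφ]
  · rw [Ctilde_pc, Ctilde_pc]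
    congr 2
    ext N
    rw [mem_pureDistillPcSet_iff hφ, mem_pureDistillPcSet_iff hφ]
  · rw [C_d, C_pc, Ctilde_d, Ctilde_pc, distillSet_zero_eq hφ, distillPcSet_zero_eq,
      pureDistillSet_zero_eq hφ, pureDistillPcSet_zero_eq hφ, sSup_logSet_Icc hfloor]
    exact ⟨rfl, rfl, rfl, rfl⟩
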